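/- Let $\mathbb{T}=\mathbb{R}/\mathbb{Z}$ and let $p\ge 1$ be an integer. Fix $x_0\in\mathbb{R}$. For a continuous function $f$ on $\mathbb{T}$ (regarded as a $1$-periodic function on $\mathbb{R}$) let $\partial_x^{-1}f$ be the mean-zero periodic primitive of the mean-free part of $f$, that is, with $g=f-\int_{\mathbb{T}}f\,dy$, $$\partial_x^{-1}f(x)=\int_{x_0}^{x}g(y)\,dy-\int_0^1\int_{x_0}^{z}g(y)\,dy\,dz$$ (this does not depend on $x_0$). Consider the Cauchy problem for the modified Hunter–Saxton equation $$\partial_t u+u^p\,\partial_x u=\tfrac12\,\partial_x^{-1}\big(\partial_x(u^p)\,\partial_x u\big),\qquad u(x,0)=u_0(x),\qquad x\in\mathbb{T}. \tag{mHS}$$ Theorem. If $u_0:\mathbb{T}\to\mathbb{R}$ is real-analytic, then there is an $\varepsilon>0$ such that (mHS) has a unique solution $u:\mathbb{T}\times(-\varepsilon,\varepsilon)\to\mathbb{R}$ that is real-analytic in the two variables $(x,t)$ jointly. That is, such a real-analytic solution exists, and any two real-analytic solutions of (mHS) on $\mathbb{T}\times(-\varepsilon,\varepsilon)$ with initial value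 $u_0$ coincide. -/

import Mathlib

/-! Functions on the circle `ℝ / ℤ` are the functions on `ℝ` that are periodic with period `1`;
integration over the circle is integration over `[0, 1]`. -/

noncomputable section

namespace ModifiedHunterSaxton

/-- The component of `f` of mean zero, `f - ∫_𝕋 f`. -/
def meanFree (f : ℝ → ℝ) (x : ℝ) : ℝ :=
  f x - ∫ y in (0 : ℝ)..1, f y

/-- The primitive `x ↦ ∫_{x₀}^x f(y) dy - ∫_𝕋 ∫_{x₀}^z f(y) dy dz` of mean zero. -/
def meanZeroPrimitive (x₀ : ℝ) (f : ℝ → ℝ) (x : ℝ) : ℝ :=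
  (∫ y in x₀..x, f y) - ∫ z in (0 : ℝ)..1, ∫ y in x₀..z, f y

/-- The operator `∂ₓ⁻¹` on continuous functions on the circle: the primitive of mean zero of the
mean-zero component of `f`. Only a function of mean zero has a periodic primitive, so the mean
has to be removed for `∂ₓ⁻¹ f` to be a function on the circle; nothing is removed from an `f` of
mean zero. The result does not depend on the base point `x₀`. -/
def invDeriv (x₀ : ℝ) (f : ℝ → ℝ) : ℝ → ℝ :=
  meanZeroPrimitive x₀ (meanFree f)

/-- The function `(x, t) ↦ u x t` on `𝕋 × (-ε, ε)` is real-analytic in `(x, t)` and solves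
`∂ₜ u + u ^ p ∂ₓ u = (1 / 2) ∂ₓ⁻¹ (∂ₓ (u ^ p) ∂ₓ u)` with `u (x, 0) = u₀ x`.
The values of `u` at times outside `(-ε, ε)` play no role. -/
structure IsAnalyticSolution (p : ℕ) (x₀ : ℝ) (u₀ : ℝ → ℝ) (ε : ℝ) (u : ℝ → ℝ → ℝ) : Prop where
  periodic : ∀ t ∈ Set.Ioo (-ε) ε, Function.Periodic (fun x => u x t) 1
  analytic : AnalyticOnNhd ℝ (fun q : ℝ × ℝ => u q.1 q.2) (Set.univ ×ˢ Set.Ioo (-ε) ε)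
  equation : ∀ x : ℝ, ∀ t ∈ Set.Ioo (-ε) ε,
    deriv (fun τ => u x τ) t + u x t ^ p * deriv (fun y => u y t) x =
      1 / 2 * invDeriv x₀
        (fun y => deriv (fun z => u z t ^ p) y * deriv (fun z => u z t) y) x
  initial : ∀ x : ℝ, u x 0 = u₀ x

end ModifiedHunterSaxton

end

/-!
For existence, expand `u` in powers of `t` with smooth periodic coefficients. The equation becomes
the fixed point equation `a = u₀ + ∂ₜ⁻¹ F(a)` for formal power series, which has a solution because
the right-hand side is contracting for the `X`-adic topology. It converges since the norm that gives
the `n`-th Taylor coefficient in `x` of the coefficient of `t ^ k` the weight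
`R ^ n ρ ^ k / binom (n + k, n)` is submultiplicative and makes `∂ₓ ∂ₜ⁻¹` an operator of norm at
most `ρ / R`, although `∂ₓ` alone is unbounded: for small `ρ` the Picard iterates stay in a fixed
ball, for the norms of both `a` and `∂ₓ a`.

For uniqueness, if the difference of two solutions is `O(t ^ k)` uniformly in `x`, then so is its
derivative in space, and by the equation also its derivative in time. Hence the difference is
`O(t ^ (k + 1))`; so it vanishes to infinite order at `t = 0`, and is zero by analyticity.
-/

open Set Filter Topology
open Function (uncurry)
open Finset.HasAntidiagonal (antidiagonal mem_antidiagonal)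
open scoped ENNReal NNReal PowerSeries ContDiff Nat

noncomputable section

namespace ModifiedHunterSaxton

/-! ### The operator `∂ₓ⁻¹` on continuous functions -/

section InvDeriv

variable {f g : ℝ → ℝ}

lemma continuous_meanFree (hf : Continuous f) : Continuous (meanFree f) :=
  hf.sub continuous_const

lemma continuous_primitive (hf : Continuous f) (x₀ : ℝ) :
    Continuous fun x => ∫ y in x₀..x, f y :=
  intervalIntegral.continuous_primitive (fun _ _ => hf.intervalIntegrable _ _) x₀

lemma invDeriv_apply (x₀ : ℝ) (f : ℝ → ℝ) (x : ℝ) :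
    invDeriv x₀ f x =
      (∫ y in x₀..x, meanFree f y) - ∫ z in (0 : ℝ)..1, ∫ y in x₀..z, meanFree f y := rfl

lemma hasDerivAt_invDeriv (hf : Continuous f) (x₀ x : ℝ) :
    HasDerivAt (invDeriv x₀ f) (meanFree f x) x :=
  ((continuous_meanFree hf).integral_hasStrictDerivAt x₀ x).hasDerivAt.sub_const _

lemma deriv_invDeriv (hf : Continuous f) (x₀ : ℝ) : deriv (invDeriv x₀ f) = meanFree f :=
  funext fun x => (hasDerivAt_invDeriv hf x₀ x).deriv

lemma deriv_meanFree (f : ℝ → ℝ) : deriv (meanFree f) = deriv f :=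
  funext fun _ => deriv_sub_const _

lemma integral_meanFree (hf : Continuous f) : ∫ y in (0 : ℝ)..1, meanFree f y = 0 := by
  simp [meanFree, intervalIntegral.integral_sub (hf.intervalIntegrable _ _)]

lemma periodic_meanFree {c : ℝ} (hper : Function.Periodic f c) :
    Function.Periodic (meanFree f) c :=
  fun x => by simp only [meanFree, hper x]

lemma periodic_invDeriv (hf : Continuous f) (hper : Function.Periodic f 1) (x₀ : ℝ) :
    Function.Periodic (invDeriv x₀ f) 1 := by
  intro x
  have hc := continuous_meanFree hf
  have hperiod : ∫ y in x..x + 1, meanFree f y = 0 := by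
    rw [(periodic_meanFree hper).intervalIntegral_add_eq x 0, zero_add, integral_meanFree hf]
  rw [invDeriv_apply, invDeriv_apply, ← intervalIntegral.integral_add_adjacent_intervals
    (hc.intervalIntegrable x₀ x) (hc.intervalIntegrable x (x + 1)), hperiod, add_zero]

lemma meanFree_add (hf : Continuous f) (hg : Continuous g) :
    meanFree (f + g) = meanFree f + meanFree g := by
  ext x
  simp only [meanFree, Pi.add_apply]
  rw [intervalIntegral.integral_add (hf.intervalIntegrable _ _) (hg.intervalIntegrable _ _)]
  ring

lemma meanFree_smul (c : ℝ) (f : ℝ → ℝ) : meanFree (c • f) = c • meanFree f := by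
  ext x
  simp [meanFree, intervalIntegral.integral_const_mul, mul_sub]

lemma invDeriv_add (hf : Continuous f) (hg : Continuous g) (x₀ : ℝ) :
    invDeriv x₀ (f + g) = invDeriv x₀ f + invDeriv x₀ g := by
  ext x
  have hf' := continuous_meanFree hf
  have hg' := continuous_meanFree hg
  simp only [Pi.add_apply, invDeriv_apply, meanFree_add hf hg,
    intervalIntegral.integral_add (hf'.intervalIntegrable _ _) (hg'.intervalIntegrable _ _)]
  rw [intervalIntegral.integral_add
    ((continuous_primitive hf' x₀).intervalIntegrable _ _)
    ((continuous_primitive hg' x₀).intervalIntegrable _ _)]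
  ring

lemma invDeriv_smul (c : ℝ) (f : ℝ → ℝ) (x₀ : ℝ) :
    invDeriv x₀ (c • f) = c • invDeriv x₀ f := by
  ext x
  simp [invDeriv_apply, meanFree_smul, intervalIntegral.integral_const_mul, mul_sub]

lemma invDeriv_sub (hf : Continuous f) (hg : Continuous g) (x₀ : ℝ) :
    invDeriv x₀ (f - g) = invDeriv x₀ f - invDeriv x₀ g := by
  rw [eq_sub_iff_add_eq, ← invDeriv_add (hf.sub hg) hg, sub_add_cancel]

lemma abs_meanFree_le {C : ℝ} (hC : ∀ x, |f x| ≤ C) (x : ℝ) : |meanFree f x| ≤ 2 * C := by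
  have hmean : |∫ y in (0 : ℝ)..1, f y| ≤ C := by
    simpa using intervalIntegral.norm_integral_le_of_norm_le_const (f := f) (a := 0) (b := 1)
      fun y _ => hC y
  calc |meanFree f x| ≤ |f x| + |∫ y in (0 : ℝ)..1, f y| := abs_sub _ _
    _ ≤ 2 * C := by linarith [hC x]

lemma invDeriv_eq_integral (hf : Continuous f) (x₀ x : ℝ) :
    invDeriv x₀ f x = ∫ z in (0 : ℝ)..1, ∫ y in z..x, meanFree f y := by
  have hc := continuous_meanFree hf
  have hsub : ∀ z, ∫ y in z..x, meanFree f y =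
      (∫ y in x₀..x, meanFree f y) - ∫ y in x₀..z, meanFree f y := fun z =>
    (intervalIntegral.integral_interval_sub_left (hc.intervalIntegrable _ _)
      (hc.intervalIntegrable _ _)).symm
  rw [funext hsub, intervalIntegral.integral_sub intervalIntegrable_const
    ((continuous_primitive hc x₀).intervalIntegrable _ _)]
  simp [invDeriv_apply]

lemma abs_invDeriv_le {C : ℝ} (hf : Continuous f) (hper : Function.Periodic f 1)
    (hC : ∀ x, |f x| ≤ C) (x₀ x : ℝ) : |invDeriv x₀ f x| ≤ 2 * C := by
  obtain ⟨y, hy, hxy⟩ := (periodic_invDeriv hf hper x₀).exists_mem_Ico₀ zero_lt_one x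
  have hC0 : 0 ≤ C := (abs_nonneg _).trans (hC 0)
  have hinner : ∀ z ∈ uIoc (0 : ℝ) 1, ‖∫ s in z..y, meanFree f s‖ ≤ 2 * C := fun z hz => by
    rw [uIoc_of_le zero_le_one] at hz
    calc ‖∫ s in z..y, meanFree f s‖ ≤ 2 * C * |y - z| :=
          intervalIntegral.norm_integral_le_of_norm_le_const fun s _ => abs_meanFree_le hC s
      _ ≤ 2 * C := mul_le_of_le_one_right (by positivity)
          (abs_le.2 ⟨by linarith [hy.1, hz.2], by linarith [hy.2, hz.1]⟩)
  rw [hxy, invDeriv_eq_integral hf]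
  simpa using intervalIntegral.norm_integral_le_of_norm_le_const hinner

lemma tendsto_invDeriv {ι : Type*} {l : Filter ι} {F : ι → ℝ → ℝ} (hF : ∀ i, Continuous (F i))
    (hFper : ∀ i, Function.Periodic (F i) 1) (hf : Continuous f) (hper : Function.Periodic f 1)
    (h : TendstoUniformly F f l) (x₀ x : ℝ) :
    Tendsto (fun i => invDeriv x₀ (F i) x) l (𝓝 (invDeriv x₀ f x)) := by
  refine Metric.tendsto_nhds.2 fun δ hδ => ?_
  filter_upwards [Metric.tendstoUniformly_iff.1 h (δ / 3) (by positivity)] with i hi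
  rw [dist_comm, Real.dist_eq, ← Pi.sub_apply, ← invDeriv_sub hf (hF i)]
  refine (abs_invDeriv_le (C := δ / 3) (hf.sub (hF i)) (hper.sub (hFper i))
    (fun y => (Real.dist_eq _ _ ▸ hi y).le) x₀ x).trans_lt ?_
  linarith

end InvDeriv

/-! ### Smooth functions on the circle -/

/-- The algebra of smooth functions on `ℝ / ℤ`. -/
def smoothCircle : Subalgebra ℝ (ℝ → ℝ) where
  carrier := {f | ContDiff ℝ ∞ f ∧ Function.Periodic f 1}
  mul_mem' hf hg := ⟨hf.1.mul hg.1, hf.2.mul hg.2⟩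
  add_mem' hf hg := ⟨hf.1.add hg.1, hf.2.add hg.2⟩
  algebraMap_mem' _ := ⟨contDiff_const, fun _ => rfl⟩

lemma contDiff_coe (f : smoothCircle) : ContDiff ℝ ∞ (f : ℝ → ℝ) := f.2.1

lemma contDiff_nat_coe (f : smoothCircle) (n : ℕ) : ContDiff ℝ n (f : ℝ → ℝ) :=
  (contDiff_coe f).of_le (by exact_mod_cast le_top)

lemma periodic_coe (f : smoothCircle) : Function.Periodic (f : ℝ → ℝ) 1 := f.2.2

lemma continuous_coe (f : smoothCircle) : Continuous (f : ℝ → ℝ) := (contDiff_coe f).continuous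

lemma differentiable_coe (f : smoothCircle) : Differentiable ℝ (f : ℝ → ℝ) :=
  (contDiff_coe f).differentiable (by simp)

lemma periodic_deriv {f : ℝ → ℝ} {c : ℝ} (hper : Function.Periodic f c) :
    Function.Periodic (deriv f) c := fun x => by
  rw [← deriv_comp_add_const, hper.funext]

/-- Differentiation of smooth functions on the circle. -/
def derivₗ : smoothCircle →ₗ[ℝ] smoothCircle where
  toFun f := ⟨deriv (f : ℝ → ℝ), (contDiff_infty_iff_deriv.1 (contDiff_coe f)).2,
    periodic_deriv (periodic_coe f)⟩
  map_add' f g := Subtype.ext <| funext fun x =>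
    deriv_add (differentiable_coe f x) (differentiable_coe g x)
  map_smul' c f := Subtype.ext <| funext fun x => deriv_const_smul c (differentiable_coe f x)

/-- The projection of the smooth functions on the circle to those of mean zero. -/
def meanFreeₗ : smoothCircle →ₗ[ℝ] smoothCircle where
  toFun f := ⟨meanFree f, (contDiff_coe f).sub contDiff_const, periodic_meanFree (periodic_coe f)⟩
  map_add' f g := Subtype.ext <| meanFree_add (continuous_coe f) (continuous_coe g)
  map_smul' c f := Subtype.ext <| meanFree_smul c f

/-- The operator `∂ₓ⁻¹` on smooth functions on the circle. -/
def invDerivₗ (x₀ : ℝ) : smoothCircle →ₗ[ℝ] smoothCircle where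
  toFun f := ⟨invDeriv x₀ f, contDiff_infty_iff_deriv.2
    ⟨fun x => (hasDerivAt_invDeriv (continuous_coe f) x₀ x).differentiableAt, by
      rw [deriv_invDeriv (continuous_coe f)]; exact contDiff_coe (meanFreeₗ f)⟩,
    periodic_invDeriv (continuous_coe f) (periodic_coe f) x₀⟩
  map_add' f g := Subtype.ext <| invDeriv_add (continuous_coe f) (continuous_coe g) x₀
  map_smul' c f := Subtype.ext <| invDeriv_smul c f x₀

@[simp] lemma coe_derivₗ (f : smoothCircle) : (derivₗ f : ℝ → ℝ) = deriv (f : ℝ → ℝ) := rfl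

@[simp] lemma coe_meanFreeₗ (f : smoothCircle) : (meanFreeₗ f : ℝ → ℝ) = meanFree f := rfl

@[simp] lemma coe_invDerivₗ (x₀ : ℝ) (f : smoothCircle) :
    (invDerivₗ x₀ f : ℝ → ℝ) = invDeriv x₀ f := rfl

lemma derivₗ_invDerivₗ (x₀ : ℝ) (f : smoothCircle) : derivₗ (invDerivₗ x₀ f) = meanFreeₗ f :=
  Subtype.ext (deriv_invDeriv (continuous_coe f) x₀)

/-! ### Taylor seminorms -/

section TaylorSup

variable {F : Type*} [NormedAddCommGroup F] [NormedSpace ℝ F]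

/-- The supremum over all base points of the norm of the `n`-th Taylor coefficient of `f`. -/
def taylorSup (n : ℕ) (f : ℝ → F) : ℝ≥0∞ :=
  ⨆ x : ℝ, ‖iteratedDeriv n f x‖ₑ / n !

lemma le_taylorSup (n : ℕ) (f : ℝ → F) (x : ℝ) : ‖iteratedDeriv n f x‖ₑ / n ! ≤ taylorSup n f :=
  le_iSup (fun x : ℝ => ‖iteratedDeriv n f x‖ₑ / n !) x

lemma taylorSup_order_zero (f : ℝ → F) : taylorSup 0 f = ⨆ x, ‖f x‖ₑ := by
  simp [taylorSup]

lemma enorm_apply_le_taylorSup (f : ℝ → F) (x : ℝ) : ‖f x‖ₑ ≤ taylorSup 0 f := by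
  simpa using le_taylorSup 0 f x

lemma taylorSup_add_le {n : ℕ} {f g : ℝ → F} (hf : ContDiff ℝ n f) (hg : ContDiff ℝ n g) :
    taylorSup n (f + g) ≤ taylorSup n f + taylorSup n g := by
  refine iSup_le fun x => ?_
  calc ‖iteratedDeriv n (f + g) x‖ₑ / n !
      ≤ ‖iteratedDeriv n f x‖ₑ / n ! + ‖iteratedDeriv n g x‖ₑ / n ! := by
        rw [iteratedDeriv_add hf.contDiffAt hg.contDiffAt, ← ENNReal.add_div]
        gcongr
        exact enorm_add_le _ _
    _ ≤ _ := add_le_add (le_taylorSup n f x) (le_taylorSup n g x)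

@[simp] lemma taylorSup_zero (n : ℕ) : taylorSup n (0 : ℝ → F) = 0 := by
  simp [taylorSup]

lemma taylorSup_const {n : ℕ} (hn : n ≠ 0) (c : F) : taylorSup n (fun _ => c) = 0 := by
  simp [taylorSup, iteratedDeriv_const, hn]

lemma taylorSup_smul (n : ℕ) (c : ℝ) (f : ℝ → F) :
    taylorSup n (c • f) = ‖c‖ₑ * taylorSup n f := by
  simp only [taylorSup, ENNReal.mul_iSup, iteratedDeriv_const_smul_field, enorm_smul,
    mul_div_assoc]

lemma taylorSup_sum_le {ι : Type*} {n : ℕ} (s : Finset ι) {f : ι → ℝ → F}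
    (hf : ∀ i, ContDiff ℝ n (f i)) :
    taylorSup n (∑ i ∈ s, f i) ≤ ∑ i ∈ s, taylorSup n (f i) := by
  classical
  induction s using Finset.induction with
  | empty => simp
  | insert i s hi ih =>
    have hsum : ContDiff ℝ n (∑ j ∈ s, f j) := by
      simpa only [← Finset.sum_fn] using ContDiff.sum fun j _ => hf j
    rw [Finset.sum_insert hi, Finset.sum_insert hi]
    exact (taylorSup_add_le (hf i) hsum).trans (add_le_add_right ih _)

lemma inv_factorial_add_mul_choose (i j : ℕ) :
    ((i + j)! : ℝ≥0∞)⁻¹ * (i + j).choose i = (i ! : ℝ≥0∞)⁻¹ * (j ! : ℝ≥0∞)⁻¹ := by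
  have hchoose : ((i + j).choose j : ℝ≥0∞) ≠ 0 := by
    exact_mod_cast (Nat.choose_pos le_add_self).ne'
  have hfact : (i ! : ℝ≥0∞) ≠ 0 := by exact_mod_cast i.factorial_ne_zero
  rw [← Nat.add_choose_mul_factorial_mul_factorial, mul_assoc, Nat.choose_symm_add]
  push_cast
  rw [ENNReal.mul_inv (.inl hchoose) (.inl (by simp)), mul_right_comm,
    ENNReal.inv_mul_cancel hchoose (by simp), one_mul,
    ENNReal.mul_inv (.inl hfact) (.inl (by simp))]

lemma taylorSup_mul_le {A : Type*} [NormedRing A] [NormedAlgebra ℝ A] {n : ℕ} {f g : ℝ → A}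
    (hf : ContDiff ℝ n f) (hg : ContDiff ℝ n g) :
    taylorSup n (f * g) ≤ ∑ ij ∈ antidiagonal n, taylorSup ij.1 f * taylorSup ij.2 g := by
  have hterm : ∀ (x : ℝ), ∀ ij ∈ antidiagonal n,
      (n ! : ℝ≥0∞)⁻¹ *
        ‖(n.choose ij.1 : A) * iteratedDeriv ij.1 f x * iteratedDeriv ij.2 g x‖ₑ ≤
      taylorSup ij.1 f * taylorSup ij.2 g := fun x ⟨i, j⟩ hij => by
    obtain rfl := mem_antidiagonal.1 hij
    calc ((i + j)! : ℝ≥0∞)⁻¹ *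
          ‖((i + j).choose i : A) * iteratedDeriv i f x * iteratedDeriv j g x‖ₑ
        ≤ ((i + j)! : ℝ≥0∞)⁻¹ *
          ((i + j).choose i * (‖iteratedDeriv i f x‖ₑ * ‖iteratedDeriv j g x‖ₑ)) := by
          gcongr
          rw [mul_assoc, ← nsmul_eq_mul, ← Nat.cast_smul_eq_nsmul ℝ, enorm_smul,
            Real.enorm_natCast]
          gcongr
          exact ENNReal.coe_le_coe.2 (nnnorm_mul_le _ _)
      _ = ‖iteratedDeriv i f x‖ₑ / i ! * (‖iteratedDeriv j g x‖ₑ / j !) := by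
          rw [← mul_assoc, inv_factorial_add_mul_choose, ENNReal.div_eq_inv_mul,
            ENNReal.div_eq_inv_mul]
          ring
      _ ≤ taylorSup i f * taylorSup j g := mul_le_mul' (le_taylorSup i f x) (le_taylorSup j g x)
  refine iSup_le fun x => ?_
  rw [iteratedDeriv_mul hf.contDiffAt hg.contDiffAt, ← Finset.Nat.sum_antidiagonal_eq_sum_range_succ
    (fun i j => (n.choose i : A) * iteratedDeriv i f x * iteratedDeriv j g x),
    ENNReal.div_eq_inv_mul]
  refine (mul_le_mul_right (enorm_sum_le _ _) _).trans ?_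
  rw [Finset.mul_sum]
  exact Finset.sum_le_sum (hterm x)

lemma taylorSup_deriv (n : ℕ) (f : ℝ → F) :
    taylorSup n (deriv f) = (n + 1) * taylorSup (n + 1) f := by
  rw [taylorSup, taylorSup, ENNReal.mul_iSup]
  refine iSup_congr fun x => ?_
  rw [← iteratedDeriv_succ', Nat.factorial_succ, ENNReal.div_eq_inv_mul, ENNReal.div_eq_inv_mul,
    ← mul_assoc]
  push_cast
  rw [ENNReal.mul_inv (.inl (by simp)) (.inr (by simp [Nat.factorial_ne_zero])), ← mul_assoc,
    ENNReal.mul_inv_cancel (by simp) (by finiteness), one_mul]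

lemma taylorSup_order_zero_le_mul {f g : ℝ → F} {c : ℝ≥0} (hc : c ≠ 0)
    (h : ∀ C : ℝ, (∀ x, ‖f x‖ ≤ C) → ∀ x, ‖g x‖ ≤ c * C) :
    taylorSup 0 g ≤ c * taylorSup 0 f := by
  rcases eq_or_ne (taylorSup 0 f) ⊤ with htop | htop
  · simp [htop, hc]
  lift taylorSup 0 f to ℝ≥0 using htop with C hC
  have hf : ∀ x, ‖f x‖ ≤ C := fun x => by
    have := hC ▸ enorm_apply_le_taylorSup f x
    exact_mod_cast this
  rw [taylorSup_order_zero]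
  exact iSup_le fun x => by exact_mod_cast h C hf x

lemma taylorSup_meanFree_le (n : ℕ) (f : ℝ → ℝ) : taylorSup n (meanFree f) ≤ 2 * taylorSup n f := by
  rcases n with _ | n
  · exact_mod_cast taylorSup_order_zero_le_mul two_ne_zero fun C hC => abs_meanFree_le hC
  · have heq : taylorSup (n + 1) (meanFree f) = taylorSup (n + 1) f := by
      simp only [taylorSup, iteratedDeriv_succ', deriv_meanFree]
    rw [heq, two_mul]
    exact le_self_add

lemma taylorSup_zero_invDeriv_le {f : ℝ → ℝ} (hf : Continuous f) (hper : Function.Periodic f 1)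
    (x₀ : ℝ) : taylorSup 0 (invDeriv x₀ f) ≤ 2 * taylorSup 0 f := by
  exact_mod_cast taylorSup_order_zero_le_mul two_ne_zero fun C hC => abs_invDeriv_le hf hper hC x₀

lemma taylorSup_succ_invDeriv_le {f : ℝ → ℝ} (hf : Continuous f) (x₀ : ℝ) (n : ℕ) :
    taylorSup (n + 1) (invDeriv x₀ f) ≤ 2 * taylorSup n f :=
  calc taylorSup (n + 1) (invDeriv x₀ f)
      ≤ (n + 1) * taylorSup (n + 1) (invDeriv x₀ f) := le_mul_of_one_le_left' le_add_self
    _ = taylorSup n (meanFree f) := by rw [← taylorSup_deriv, deriv_invDeriv hf]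
    _ ≤ 2 * taylorSup n f := taylorSup_meanFree_le n f

end TaylorSup

/-! ### Power series in time -/

section Coeffwise

variable {R A B : Type*} [CommSemiring R] [Ring A] [Module R A] [Ring B] [Module R B]

/-- The linear map on formal power series that acts as `L` on each coefficient. -/
def coeffwise (L : A →ₗ[R] B) : A⟦X⟧ →ₗ[R] B⟦X⟧ where
  toFun a := PowerSeries.mk fun k => L (PowerSeries.coeff k a)
  map_add' a b := by ext1 k; simp
  map_smul' c a := by ext1 k; simp

@[simp] lemma coeff_coeffwise (L : A →ₗ[R] B) (a : A⟦X⟧) (k : ℕ) :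
    PowerSeries.coeff k (coeffwise L a) = L (PowerSeries.coeff k a) := by
  simp [coeffwise]

lemma coeffwise_C (L : A →ₗ[R] B) (f : A) :
    coeffwise L (PowerSeries.C f) = PowerSeries.C (L f) := by
  ext1 k
  rw [coeff_coeffwise, PowerSeries.coeff_C, PowerSeries.coeff_C, apply_ite L, map_zero]

lemma X_pow_dvd_coeffwise_sub (L : A →ₗ[R] B) {a b : A⟦X⟧} {n : ℕ}
    (h : PowerSeries.X ^ n ∣ a - b) : PowerSeries.X ^ n ∣ coeffwise L a - coeffwise L b := by
  rw [← map_sub]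
  rw [PowerSeries.X_pow_dvd_iff] at h ⊢
  intro m hm
  rw [coeff_coeffwise, h m hm, map_zero]

end Coeffwise

section FormalPrimitive

variable {A : Type*} [CommRing A] [Algebra ℝ A]

/-- The formal primitive of a power series in time that vanishes at time zero. -/
def formalPrimitive : A⟦X⟧ →ₗ[ℝ] A⟦X⟧ where
  toFun a := PowerSeries.mk fun k =>
    Nat.casesOn k 0 fun j => ((j + 1 : ℕ) : ℝ)⁻¹ • PowerSeries.coeff j a
  map_add' a b := by ext1 k; cases k <;> simp
  map_smul' c a := by ext1 k; cases k <;> simp [smul_comm c]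

@[simp] lemma coeff_zero_formalPrimitive (a : A⟦X⟧) :
    PowerSeries.coeff 0 (formalPrimitive a) = 0 := by
  simp [formalPrimitive, -PowerSeries.coeff_zero_eq_constantCoeff]

@[simp] lemma coeff_succ_formalPrimitive (a : A⟦X⟧) (k : ℕ) :
    PowerSeries.coeff (k + 1) (formalPrimitive a) =
      ((k + 1 : ℕ) : ℝ)⁻¹ • PowerSeries.coeff k a := by
  simp [formalPrimitive]

lemma derivative_formalPrimitive (a : A⟦X⟧) :
    PowerSeries.derivative A (formalPrimitive a) = a := by
  ext1 k
  rw [PowerSeries.coeff_derivative, coeff_succ_formalPrimitive, smul_mul_assoc, mul_comm,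
    ← Nat.cast_succ, ← nsmul_eq_mul, ← Nat.cast_smul_eq_nsmul ℝ, smul_smul,
    inv_mul_cancel₀ (by positivity), one_smul]

lemma coeffwise_formalPrimitive {B : Type*} [CommRing B] [Algebra ℝ B] (L : A →ₗ[ℝ] B)
    (a : A⟦X⟧) : coeffwise L (formalPrimitive a) = formalPrimitive (coeffwise L a) := by
  ext1 k
  cases k <;> simp [-PowerSeries.coeff_zero_eq_constantCoeff]

lemma X_pow_succ_dvd_formalPrimitive_sub {a b : A⟦X⟧} {n : ℕ} (h : PowerSeries.X ^ n ∣ a - b) :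
    PowerSeries.X ^ (n + 1) ∣ formalPrimitive a - formalPrimitive b := by
  rw [← map_sub]
  rw [PowerSeries.X_pow_dvd_iff] at h ⊢
  rintro (_ | m) hm
  · rw [coeff_zero_formalPrimitive]
  · rw [coeff_succ_formalPrimitive, h m (by omega), smul_zero]

end FormalPrimitive

lemma X_pow_dvd_iterate_sub_iterate {A : Type*} [Ring A] {Φ : A⟦X⟧ → A⟦X⟧}
    (hΦ : ∀ n a b, PowerSeries.X ^ n ∣ a - b → PowerSeries.X ^ (n + 1) ∣ Φ a - Φ b)
    (a b : A⟦X⟧) (j : ℕ) : PowerSeries.X ^ j ∣ Φ^[j] a - Φ^[j] b := by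
  induction j with
  | zero => simp
  | succ j ih =>
    rw [Function.iterate_succ_apply', Function.iterate_succ_apply']
    exact hΦ j _ _ ih

lemma exists_fixedPoint_of_X_pow_dvd {A : Type*} [Ring A] {Φ : A⟦X⟧ → A⟦X⟧}
    (hΦ : ∀ n a b, PowerSeries.X ^ n ∣ a - b → PowerSeries.X ^ (n + 1) ∣ Φ a - Φ b)
    (a₀ : A⟦X⟧) : ∃ a, Φ a = a ∧ ∀ j, PowerSeries.X ^ j ∣ a - Φ^[j] a₀ := by
  set a : A⟦X⟧ := PowerSeries.mk fun k => PowerSeries.coeff k (Φ^[k + 1] a₀) with ha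
  have hlim : ∀ j, PowerSeries.X ^ j ∣ a - Φ^[j] a₀ := fun j => by
    refine PowerSeries.X_pow_dvd_iff.2 fun k hk => ?_
    obtain ⟨i, rfl⟩ := Nat.exists_eq_add_of_lt hk
    have hagree := PowerSeries.X_pow_dvd_iff.1
      (X_pow_dvd_iterate_sub_iterate hΦ a₀ (Φ^[i] a₀) (k + 1)) k k.lt_succ_self
    rw [← Function.iterate_add_apply, add_right_comm] at hagree
    rw [map_sub, ha, PowerSeries.coeff_mk, ← map_sub, hagree]
  refine ⟨a, ?_, hlim⟩
  ext1 k
  have hstep := dvd_sub (hΦ k _ _ (hlim k)) (Function.iterate_succ_apply' Φ k a₀ ▸ hlim (k + 1))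
  rw [sub_sub_sub_cancel_right] at hstep
  have hcoeff := PowerSeries.X_pow_dvd_iff.1 hstep k k.lt_succ_self
  rwa [map_sub, sub_eq_zero] at hcoeff

/-! ### The weighted norm -/

section Weight

variable (R ρ : ℝ≥0)

/-- The weight `R ^ n ρ ^ k / binom (n + k, n)` of the `n`-th Taylor coefficient in space of the
`k`-th coefficient in time. Without the binomial coefficient, differentiation in space followed by
integration in time would multiply the weights by the unbounded factors `(n + 1) / (k + 1)`; with
it, these factors cancel. -/
def weight (n k : ℕ) : ℝ≥0 :=
  R ^ n * ρ ^ k / (n + k).choose n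

lemma choose_add_pos (n k : ℕ) : (0 : ℝ≥0) < (n + k).choose n := by
  exact_mod_cast Nat.choose_pos le_self_add

lemma choose_mul_choose_le (n m i j : ℕ) :
    (n + i).choose n * (m + j).choose m ≤ (n + m + (i + j)).choose (n + m) := by
  rw [add_add_add_comm n m i j, Nat.add_choose_eq (n + i)]
  exact Finset.single_le_sum
    (f := fun ij : ℕ × ℕ => (n + i).choose ij.1 * (m + j).choose ij.2)
    (fun _ _ => Nat.zero_le _) (a := (n, m)) (mem_antidiagonal.2 rfl)

lemma weight_add_le (n m i j : ℕ) :
    weight R ρ (n + m) (i + j) ≤ weight R ρ n i * weight R ρ m j := by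
  have hchoose : ((n + i).choose n * (m + j).choose m : ℝ≥0) ≤
      (n + m + (i + j)).choose (n + m) := by
    exact_mod_cast choose_mul_choose_le n m i j
  have hpos := mul_pos (choose_add_pos n i) (choose_add_pos m j)
  rw [weight, weight, weight, div_mul_div_comm,
    show R ^ (n + m) * ρ ^ (i + j) = R ^ n * ρ ^ i * (R ^ m * ρ ^ j) by ring]
  gcongr

lemma weight_zero_right (n : ℕ) : weight R ρ n 0 = R ^ n := by
  simp [weight]

lemma weight_succ_right_le (n k : ℕ) : weight R ρ n (k + 1) ≤ ρ * weight R ρ n k := by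
  have hchoose : ((n + k).choose n : ℝ≥0) ≤ (n + (k + 1)).choose n := by
    exact_mod_cast Nat.choose_le_choose n (by omega)
  have hpos := choose_add_pos n k
  rw [weight, weight, show R ^ n * ρ ^ (k + 1) = ρ * (R ^ n * ρ ^ k) by ring, mul_div_assoc]
  gcongr

lemma weight_succ_left_le (n k : ℕ) : weight R ρ (n + 1) k ≤ R * weight R ρ n k := by
  have hchoose : ((n + k).choose n : ℝ≥0) ≤ (n + 1 + k).choose (n + 1) := by
    rw [Nat.choose_symm_add, Nat.choose_symm_add]
    exact_mod_cast Nat.choose_le_choose k (by omega)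
  have hpos := choose_add_pos n k
  rw [weight, weight, show R ^ (n + 1) * ρ ^ k = R * (R ^ n * ρ ^ k) by ring, mul_div_assoc]
  gcongr

lemma succ_mul_weight_succ_right (n k : ℕ) :
    (n + 1) * (R * weight R ρ n (k + 1)) = (k + 1) * (ρ * weight R ρ (n + 1) k) := by
  have hchoose : ((n + 1 + k).choose (n + 1) : ℝ≥0) * (n + 1) =
      (n + (k + 1)).choose n * (k + 1) := by
    have h := Nat.choose_succ_right_eq (n + (k + 1)) n
    rw [Nat.add_sub_cancel_left] at h
    rw [Nat.add_right_comm n 1 k]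
    exact_mod_cast h
  have h₁ := (choose_add_pos n (k + 1)).ne'
  have h₂ := (choose_add_pos (n + 1) k).ne'
  rw [weight, weight]
  field_simp
  linear_combination (R ^ (n + 1) * ρ ^ (k + 1)) * hchoose

lemma le_weight (n k : ℕ) : (R / 2) ^ n * (ρ / 2) ^ k ≤ weight R ρ n k := by
  have hchoose : ((n + k).choose n : ℝ≥0) ≤ 2 ^ (n + k) := by
    exact_mod_cast Nat.choose_le_two_pow _ _
  have hpos := choose_add_pos n k
  rw [weight, div_pow, div_pow, div_mul_div_comm, ← pow_add]
  gcongr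

end Weight

lemma hasSum_sum_antidiagonal {A M : Type*} [AddMonoid A] [Finset.HasAntidiagonal A]
    [AddCommMonoid M] [TopologicalSpace M] [ContinuousAdd M] [RegularSpace M] {F : A × A → M}
    {s : M} (h : HasSum F s) : HasSum (fun m => ∑ ij ∈ antidiagonal m, F ij) s := by
  refine (Finset.HasAntidiagonal.sigmaAntidiagonalEquivProd.hasSum_iff.2 h).sigma fun m => ?_
  have hfiber := hasSum_fintype fun ij : antidiagonal m => F ij
  rwa [Finset.sum_coe_sort (antidiagonal m) F] at hfiber

lemma tsum_sum_antidiagonal (F : ℕ → ℕ → ℝ≥0∞) :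
    ∑' n, ∑ ij ∈ antidiagonal n, F ij.1 ij.2 = ∑' i, ∑' j, F i j := by
  rw [← ENNReal.tsum_prod]
  exact (hasSum_sum_antidiagonal (F := fun ij : ℕ × ℕ => F ij.1 ij.2)
    ENNReal.summable.hasSum).tsum_eq

/-- The weighted sum of the Taylor coefficients of a power series in time, infinite if it diverges.
For `R = 0` only the suprema of the coefficients remain, weighted by `ρ ^ k`, so finiteness then
means normal convergence for `|t| ≤ ρ`. -/
def seriesNorm (R ρ : ℝ≥0) (a : smoothCircle⟦X⟧) : ℝ≥0∞ :=
  ∑' k, ∑' n, taylorSup n (PowerSeries.coeff k a).1 * weight R ρ n k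

section SeriesNorm

variable (R ρ : ℝ≥0) (a b : smoothCircle⟦X⟧)

@[simp] lemma seriesNorm_zero : seriesNorm R ρ 0 = 0 := by
  simp [seriesNorm]

lemma seriesNorm_add_le : seriesNorm R ρ (a + b) ≤ seriesNorm R ρ a + seriesNorm R ρ b := by
  simp only [seriesNorm, ← ENNReal.tsum_add, ← add_mul, map_add]
  gcongr with k n
  exact taylorSup_add_le (contDiff_nat_coe _ n) (contDiff_nat_coe _ n)

lemma seriesNorm_smul (c : ℝ) : seriesNorm R ρ (c • a) = ‖c‖ₑ * seriesNorm R ρ a := by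
  simp only [seriesNorm, ← ENNReal.tsum_mul_left, PowerSeries.coeff_smul, SetLike.val_smul,
    taylorSup_smul, mul_assoc]

@[simp] lemma seriesNorm_neg : seriesNorm R ρ (-a) = seriesNorm R ρ a := by
  rw [← neg_one_smul ℝ a, seriesNorm_smul, enorm_neg, enorm_one, one_mul]

lemma seriesNorm_C (f : smoothCircle) :
    seriesNorm R ρ (PowerSeries.C f) = ∑' n, taylorSup n (f : ℝ → ℝ) * (R : ℝ≥0∞) ^ n := by
  rw [seriesNorm, tsum_eq_single 0]
  · simp [weight_zero_right]
  · intro k hk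
    simp [PowerSeries.coeff_C, hk]

lemma seriesNorm_one_le : seriesNorm R ρ 1 ≤ 1 := by
  rw [← map_one (PowerSeries.C (R := smoothCircle)), seriesNorm_C, tsum_eq_single 0]
  · simp [taylorSup_order_zero]
  · intro n hn
    rw [show ((1 : smoothCircle) : ℝ → ℝ) = fun _ => 1 from rfl, taylorSup_const hn, zero_mul]

lemma taylorSup_coeff_mul_mul_weight_le (n k : ℕ) :
    taylorSup n (PowerSeries.coeff k (a * b)).1 * weight R ρ n k ≤
      ∑ ij ∈ antidiagonal k, ∑ lm ∈ antidiagonal n,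
        taylorSup lm.1 (PowerSeries.coeff ij.1 a).1 * weight R ρ lm.1 ij.1 *
          (taylorSup lm.2 (PowerSeries.coeff ij.2 b).1 * weight R ρ lm.2 ij.2) := by
  rw [PowerSeries.coeff_mul, AddSubmonoidClass.coe_finsetSum]
  refine (mul_le_mul_left (taylorSup_sum_le _ fun ij => contDiff_nat_coe _ n) _).trans ?_
  rw [Finset.sum_mul]
  refine Finset.sum_le_sum fun ij hij => ?_
  refine (mul_le_mul_left
    (taylorSup_mul_le (contDiff_nat_coe _ n) (contDiff_nat_coe _ n)) _).trans ?_
  rw [Finset.sum_mul]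
  refine Finset.sum_le_sum fun lm hlm => ?_
  have hweight : (weight R ρ n k : ℝ≥0∞) ≤ weight R ρ lm.1 ij.1 * weight R ρ lm.2 ij.2 := by
    rw [← mem_antidiagonal.1 hij, ← mem_antidiagonal.1 hlm]
    exact_mod_cast weight_add_le R ρ lm.1 lm.2 ij.1 ij.2
  exact (mul_le_mul_right hweight _).trans_eq (mul_mul_mul_comm _ _ _ _)

lemma seriesNorm_mul_le : seriesNorm R ρ (a * b) ≤ seriesNorm R ρ a * seriesNorm R ρ b := by
  set A : ℕ → ℕ → ℝ≥0∞ := fun k n =>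
    taylorSup n (PowerSeries.coeff k a).1 * weight R ρ n k
  set B : ℕ → ℕ → ℝ≥0∞ := fun k n =>
    taylorSup n (PowerSeries.coeff k b).1 * weight R ρ n k
  calc seriesNorm R ρ (a * b)
      ≤ ∑' k, ∑' n, ∑ ij ∈ antidiagonal k, ∑ lm ∈ antidiagonal n, A ij.1 lm.1 * B ij.2 lm.2 :=
        ENNReal.tsum_le_tsum fun k => ENNReal.tsum_le_tsum fun n =>
          taylorSup_coeff_mul_mul_weight_le R ρ a b n k
    _ = ∑' k, ∑ ij ∈ antidiagonal k, ∑' l, ∑' m, A ij.1 l * B ij.2 m := by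
        refine tsum_congr fun k => ?_
        rw [Summable.tsum_finsetSum fun _ _ => ENNReal.summable]
        exact Finset.sum_congr rfl fun ij _ => tsum_sum_antidiagonal fun l m => A ij.1 l * B ij.2 m
    _ = ∑' i, ∑' j, ∑' l, ∑' m, A i l * B j m :=
        tsum_sum_antidiagonal fun i j => ∑' l, ∑' m, A i l * B j m
    _ = seriesNorm R ρ a * seriesNorm R ρ b := by
        simp only [ENNReal.tsum_mul_left, ENNReal.tsum_mul_right, A, B, seriesNorm]

lemma seriesNorm_pow_le (n : ℕ) : seriesNorm R ρ (a ^ n) ≤ seriesNorm R ρ a ^ n := by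
  induction n with
  | zero => simpa using seriesNorm_one_le R ρ
  | succ n ih =>
    rw [pow_succ, pow_succ]
    exact (seriesNorm_mul_le R ρ _ _).trans (mul_le_mul_left ih _)

lemma seriesNorm_formalPrimitive :
    seriesNorm R ρ (formalPrimitive a) = ∑' k, ∑' n, ((k + 1 : ℕ) : ℝ≥0∞)⁻¹ *
      (taylorSup n (PowerSeries.coeff k a).1 * weight R ρ n (k + 1)) := by
  have henorm : ∀ k : ℕ, ‖((k + 1 : ℕ) : ℝ)⁻¹‖ₑ = ((k + 1 : ℕ) : ℝ≥0∞)⁻¹ := fun k => by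
    rw [enorm_inv (by positivity), Real.enorm_natCast]
  rw [seriesNorm, tsum_eq_zero_add' ENNReal.summable]
  simp only [coeff_zero_formalPrimitive, ZeroMemClass.coe_zero, taylorSup_zero, zero_mul,
    tsum_zero, zero_add, coeff_succ_formalPrimitive, SetLike.val_smul, taylorSup_smul, henorm,
    mul_assoc]

lemma seriesNorm_formalPrimitive_le :
    seriesNorm R ρ (formalPrimitive a) ≤ ρ * seriesNorm R ρ a := by
  rw [seriesNorm_formalPrimitive, seriesNorm]
  simp only [← ENNReal.tsum_mul_left]
  refine ENNReal.tsum_le_tsum fun k => ENNReal.tsum_le_tsum fun n => ?_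
  have hinv : ((k + 1 : ℕ) : ℝ≥0∞)⁻¹ ≤ 1 := ENNReal.inv_le_one.2 (by simp)
  have hweight : (weight R ρ n (k + 1) : ℝ≥0∞) ≤ ρ * weight R ρ n k := by
    exact_mod_cast weight_succ_right_le R ρ n k
  rw [mul_left_comm (ρ : ℝ≥0∞)]
  exact mul_le_of_le_one_of_le hinv (mul_le_mul_right hweight _)

lemma mul_seriesNorm_formalPrimitive_derivₗ_le :
    R * seriesNorm R ρ (formalPrimitive (coeffwise derivₗ a)) ≤ ρ * seriesNorm R ρ a := by
  rw [seriesNorm_formalPrimitive, seriesNorm]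
  simp only [← ENNReal.tsum_mul_left, coeff_coeffwise, coe_derivₗ, taylorSup_deriv]
  refine ENNReal.tsum_le_tsum fun k => ?_
  refine le_trans (ENNReal.tsum_le_tsum fun n => le_of_eq ?_)
    (ENNReal.tsum_comp_le_tsum_of_injective Nat.succ_injective fun n =>
      ρ * (taylorSup n (PowerSeries.coeff k a).1 * weight R ρ n k))
  have hk : ((k + 1 : ℕ) : ℝ≥0∞)⁻¹ * ((k + 1 : ℕ) : ℝ≥0∞) = 1 :=
    ENNReal.inv_mul_cancel (by simp) (by finiteness)
  have hweight : ((n : ℝ≥0∞) + 1) * (R * weight R ρ n (k + 1)) =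
      ((k + 1 : ℕ) : ℝ≥0∞) * (ρ * weight R ρ (n + 1) k) := by
    exact_mod_cast congrArg ((↑) : ℝ≥0 → ℝ≥0∞) (succ_mul_weight_succ_right R ρ n k)
  calc _ = ((k + 1 : ℕ) : ℝ≥0∞)⁻¹ * taylorSup (n + 1) (PowerSeries.coeff k a).1 *
        (((n : ℝ≥0∞) + 1) * (R * weight R ρ n (k + 1))) := by ring
    _ = (((k + 1 : ℕ) : ℝ≥0∞)⁻¹ * ((k + 1 : ℕ) : ℝ≥0∞)) *
        (ρ * (taylorSup (n + 1) (PowerSeries.coeff k a).1 * weight R ρ (n + 1) k)) := by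
      rw [hweight]; ring
    _ = _ := by rw [hk, one_mul]

lemma seriesNorm_coeffwise_meanFreeₗ_le :
    seriesNorm R ρ (coeffwise meanFreeₗ a) ≤ 2 * seriesNorm R ρ a := by
  simp only [seriesNorm, ← ENNReal.tsum_mul_left, coeff_coeffwise, coe_meanFreeₗ, ← mul_assoc]
  gcongr with k n
  exact taylorSup_meanFree_le _ _

lemma seriesNorm_coeffwise_invDerivₗ_le (x₀ : ℝ) :
    seriesNorm R ρ (coeffwise (invDerivₗ x₀) a) ≤ (2 + 2 * R) * seriesNorm R ρ a := by
  simp only [seriesNorm, ← ENNReal.tsum_mul_left, coeff_coeffwise, coe_invDerivₗ]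
  refine ENNReal.tsum_le_tsum fun k => ?_
  set f := PowerSeries.coeff k a
  rw [tsum_eq_zero_add' ENNReal.summable, ENNReal.tsum_mul_left, add_mul]
  refine add_le_add ?_ ?_
  · refine le_trans ?_ (mul_le_mul_right (ENNReal.le_tsum 0) _)
    rw [← mul_assoc]
    gcongr
    exact taylorSup_zero_invDeriv_le (continuous_coe f) (periodic_coe f) x₀
  · rw [← ENNReal.tsum_mul_left]
    refine ENNReal.tsum_le_tsum fun n => ?_
    have hweight : (weight R ρ (n + 1) k : ℝ≥0∞) ≤ R * weight R ρ n k := by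
      exact_mod_cast weight_succ_left_le R ρ n k
    calc _ ≤ 2 * taylorSup n (f : ℝ → ℝ) * (R * weight R ρ n k) :=
          mul_le_mul' (taylorSup_succ_invDeriv_le (continuous_coe f) x₀ n) hweight
      _ = _ := by ring

lemma seriesNorm_le_of_X_pow_dvd {N : ℝ≥0∞} {a : smoothCircle⟦X⟧} {b : ℕ → smoothCircle⟦X⟧}
    (h : ∀ j, PowerSeries.X ^ j ∣ a - b j) (hb : ∀ j, seriesNorm R ρ (b j) ≤ N) :
    seriesNorm R ρ a ≤ N := by
  refine ENNReal.tsum_le_of_sum_range_le fun j => ?_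
  refine le_trans (le_of_eq ?_) ((ENNReal.sum_le_tsum (Finset.range j)).trans (hb j))
  refine Finset.sum_congr rfl fun k hk => ?_
  have hcoeff := PowerSeries.X_pow_dvd_iff.1 (h j) k (Finset.mem_range.1 hk)
  rw [map_sub, sub_eq_zero] at hcoeff
  rw [hcoeff]

end SeriesNorm

/-! ### The formal solution -/

section FormalSolution

variable (p : ℕ) (x₀ : ℝ) {R ρ : ℝ≥0} {N : ℝ≥0∞} {a b : smoothCircle⟦X⟧}

/-- The right-hand side of the equation solved for `∂ₜ u`, as an operator on power series in time
with coefficients on the circle. The product rule turns `½ ∂ₓ(u ^ p) ∂ₓu` into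
`(p / 2) u ^ (p - 1) (∂ₓu) ^ 2`. -/
def formalField (a : smoothCircle⟦X⟧) : smoothCircle⟦X⟧ :=
  -(a ^ p * coeffwise derivₗ a) +
    (p / 2 : ℝ) • coeffwise (invDerivₗ x₀)
      (a ^ (p - 1) * (coeffwise derivₗ a * coeffwise derivₗ a))

/-- The Picard operator of the equation with initial value `f`. -/
def formalPicard (f : smoothCircle) (a : smoothCircle⟦X⟧) : smoothCircle⟦X⟧ :=
  PowerSeries.C f + formalPrimitive (formalField p x₀ a)

lemma X_pow_succ_dvd_formalPicard_sub (f : smoothCircle) {n : ℕ} (h : PowerSeries.X ^ n ∣ a - b) :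
    PowerSeries.X ^ (n + 1) ∣ formalPicard p x₀ f a - formalPicard p x₀ f b := by
  have hderiv := X_pow_dvd_coeffwise_sub derivₗ h
  have hpow (q : ℕ) : PowerSeries.X ^ n ∣ a ^ q - b ^ q := h.trans (sub_dvd_pow_sub_pow a b q)
  have htransport := dvd_mul_sub_mul (hpow p) hderiv
  have hnonlocal := X_pow_dvd_coeffwise_sub (invDerivₗ x₀)
    (dvd_mul_sub_mul (hpow (p - 1)) (dvd_mul_sub_mul hderiv hderiv))
  rw [formalPicard, formalPicard, add_sub_add_left_eq_sub]
  refine X_pow_succ_dvd_formalPrimitive_sub ?_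
  rw [formalField, formalField, add_sub_add_comm, neg_sub_neg, ← smul_sub, Algebra.smul_def]
  exact dvd_add (dvd_sub_comm.1 htransport) (hnonlocal.mul_left _)

lemma seriesNorm_transport_le (ha : seriesNorm R ρ a ≤ N)
    (hda : seriesNorm R ρ (coeffwise derivₗ a) ≤ N) :
    seriesNorm R ρ (a ^ p * coeffwise derivₗ a) ≤ N ^ p * N :=
  (seriesNorm_mul_le R ρ _ _).trans <|
    mul_le_mul' ((seriesNorm_pow_le R ρ _ _).trans (pow_le_pow_left' ha _)) hda

lemma seriesNorm_quadratic_le (ha : seriesNorm R ρ a ≤ N)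
    (hda : seriesNorm R ρ (coeffwise derivₗ a) ≤ N) :
    seriesNorm R ρ (a ^ (p - 1) * (coeffwise derivₗ a * coeffwise derivₗ a)) ≤
      N ^ (p - 1) * (N * N) :=
  (seriesNorm_mul_le R ρ _ _).trans <| mul_le_mul'
    ((seriesNorm_pow_le R ρ _ _).trans (pow_le_pow_left' ha _))
    ((seriesNorm_mul_le R ρ _ _).trans (mul_le_mul' hda hda))

/-- A bound for `∂ₜ⁻¹ F` and `∂ₓ ∂ₜ⁻¹ F`, up to the factor `ρ`, where `F` is the right-hand side of
the equation and `N` bounds the norms of the solution and of its derivative in space. The term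
`R⁻¹` stems from `∂ₓ ∂ₜ⁻¹` applied to the transport term. -/
def fieldBound (R : ℝ≥0) (N : ℝ≥0∞) : ℝ≥0∞ :=
  (1 + (R : ℝ≥0∞)⁻¹) * (N ^ p * N) +
    ‖(p / 2 : ℝ)‖ₑ * ((2 + 2 * R) * (N ^ (p - 1) * (N * N)))

lemma fieldBound_ne_top (hR : R ≠ 0) (hN : N ≠ ⊤) : fieldBound p R N ≠ ⊤ := by
  have hR' : (R : ℝ≥0∞)⁻¹ ≠ ⊤ := by simpa using hR
  rw [fieldBound]
  finiteness

lemma seriesNorm_formalPicard_le (f : smoothCircle) (ha : seriesNorm R ρ a ≤ N)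
    (hda : seriesNorm R ρ (coeffwise derivₗ a) ≤ N) :
    seriesNorm R ρ (formalPicard p x₀ f a) ≤
      seriesNorm R ρ (PowerSeries.C f) + ρ * fieldBound p R N := by
  refine (seriesNorm_add_le R ρ _ _).trans (add_le_add_right ?_ _)
  refine (seriesNorm_formalPrimitive_le R ρ _).trans ?_
  gcongr
  refine (seriesNorm_add_le R ρ _ _).trans (add_le_add ?_ ?_)
  · rw [seriesNorm_neg]
    exact (seriesNorm_transport_le p ha hda).trans (le_mul_of_one_le_left' le_self_add)
  · rw [seriesNorm_smul]
    gcongr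
    refine (seriesNorm_coeffwise_invDerivₗ_le R ρ _ x₀).trans ?_
    gcongr
    exact seriesNorm_quadratic_le p ha hda

lemma coeffwise_derivₗ_formalPicard (f : smoothCircle) (a : smoothCircle⟦X⟧) :
    coeffwise derivₗ (formalPicard p x₀ f a) =
      PowerSeries.C (derivₗ f) + (-formalPrimitive (coeffwise derivₗ (a ^ p * coeffwise derivₗ a)) +
        (p / 2 : ℝ) • formalPrimitive (coeffwise meanFreeₗ
          (a ^ (p - 1) * (coeffwise derivₗ a * coeffwise derivₗ a)))) := by
  have hcancel (c : smoothCircle⟦X⟧) :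
      coeffwise derivₗ (coeffwise (invDerivₗ x₀) c) = coeffwise meanFreeₗ c := by
    ext1 k
    simp only [coeff_coeffwise, derivₗ_invDerivₗ]
  simp only [formalPicard, formalField, map_add, map_neg, map_smul, coeffwise_C,
    coeffwise_formalPrimitive, hcancel]

lemma seriesNorm_coeffwise_derivₗ_formalPicard_le (hR : R ≠ 0) (f : smoothCircle)
    (ha : seriesNorm R ρ a ≤ N) (hda : seriesNorm R ρ (coeffwise derivₗ a) ≤ N) :
    seriesNorm R ρ (coeffwise derivₗ (formalPicard p x₀ f a)) ≤
      seriesNorm R ρ (PowerSeries.C (derivₗ f)) + ρ * fieldBound p R N := by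
  rw [coeffwise_derivₗ_formalPicard, fieldBound, mul_add]
  refine (seriesNorm_add_le R ρ _ _).trans (add_le_add_right ?_ _)
  refine (seriesNorm_add_le R ρ _ _).trans (add_le_add ?_ ?_)
  · rw [seriesNorm_neg]
    calc _ ≤ (R : ℝ≥0∞)⁻¹ * (ρ * seriesNorm R ρ (a ^ p * coeffwise derivₗ a)) := by
          rw [← ENNReal.div_eq_inv_mul,
            ENNReal.le_div_iff_mul_le (.inl (by simpa using hR)) (.inl (by simp)), mul_comm]
          exact mul_seriesNorm_formalPrimitive_derivₗ_le R ρ _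
      _ = ρ * ((R : ℝ≥0∞)⁻¹ * seriesNorm R ρ (a ^ p * coeffwise derivₗ a)) :=
          mul_left_comm _ _ _
      _ ≤ ρ * ((1 + (R : ℝ≥0∞)⁻¹) * (N ^ p * N)) := by
          gcongr
          · exact le_add_self
          · exact seriesNorm_transport_le p ha hda
  · rw [seriesNorm_smul, mul_left_comm (ρ : ℝ≥0∞)]
    refine mul_le_mul_right ((seriesNorm_formalPrimitive_le R ρ _).trans ?_) _
    gcongr
    refine (seriesNorm_coeffwise_meanFreeₗ_le R ρ _).trans ?_
    gcongr
    · exact le_self_add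
    · exact seriesNorm_quadratic_le p ha hda

lemma seriesNorm_iterate_formalPicard_le (hR : R ≠ 0) {f : smoothCircle}
    (hf : seriesNorm R ρ (PowerSeries.C f) + ρ * fieldBound p R N ≤ N)
    (hdf : seriesNorm R ρ (PowerSeries.C (derivₗ f)) + ρ * fieldBound p R N ≤ N) (j : ℕ) :
    seriesNorm R ρ ((formalPicard p x₀ f)^[j] 0) ≤ N ∧
      seriesNorm R ρ (coeffwise derivₗ ((formalPicard p x₀ f)^[j] 0)) ≤ N := by
  induction j with
  | zero => simp
  | succ j ih =>
    rw [Function.iterate_succ_apply']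
    exact ⟨(seriesNorm_formalPicard_le p x₀ f ih.1 ih.2).trans hf,
      (seriesNorm_coeffwise_derivₗ_formalPicard_le p x₀ hR f ih.1 ih.2).trans hdf⟩

lemma exists_formalPicard_fixedPoint {f : smoothCircle} (hR : R ≠ 0)
    (hf : ∑' n, taylorSup n (f : ℝ → ℝ) * (R : ℝ≥0∞) ^ n ≠ ⊤)
    (hdf : ∑' n, taylorSup n (deriv (f : ℝ → ℝ)) * (R : ℝ≥0∞) ^ n ≠ ⊤) :
    ∃ (a : smoothCircle⟦X⟧) (ρ : ℝ≥0), formalPicard p x₀ f a = a ∧ 0 < ρ ∧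
      seriesNorm R ρ a ≠ ⊤ ∧ seriesNorm R ρ (coeffwise derivₗ a) ≠ ⊤ := by
  obtain ⟨a, ha, happrox⟩ := exists_fixedPoint_of_X_pow_dvd
    (fun n a b => X_pow_succ_dvd_formalPicard_sub p x₀ f (n := n)) 0
  set N := ∑' n, taylorSup n (f : ℝ → ℝ) * (R : ℝ≥0∞) ^ n +
    ∑' n, taylorSup n (deriv (f : ℝ → ℝ)) * (R : ℝ≥0∞) ^ n + 1
  have hN : N ≠ ⊤ := by finiteness
  lift fieldBound p R N to ℝ≥0 using fieldBound_ne_top p hR hN with K hK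
  have hK1 : ((K + 1)⁻¹ : ℝ≥0) * fieldBound p R N ≤ 1 := by
    rw [← hK, ← ENNReal.coe_mul, ← ENNReal.coe_one, ENNReal.coe_le_coe,
      inv_mul_le_one₀ (by positivity)]
    exact le_self_add
  have hiter := seriesNorm_iterate_formalPicard_le p x₀ (f := f) (ρ := (K + 1)⁻¹) hR
    (by rw [seriesNorm_C]; exact add_le_add le_self_add hK1)
    (by rw [seriesNorm_C]; exact add_le_add le_add_self hK1)
  exact ⟨a, (K + 1)⁻¹, ha, by positivity,
    ne_top_of_le_ne_top hN (seriesNorm_le_of_X_pow_dvd R _ happrox fun j => (hiter j).1),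
    ne_top_of_le_ne_top hN (seriesNorm_le_of_X_pow_dvd R _
      (fun j => X_pow_dvd_coeffwise_sub derivₗ (happrox j)) fun j => (hiter j).2)⟩

lemma coeff_zero_of_formalPicard_eq {f : smoothCircle} (ha : formalPicard p x₀ f a = a) :
    PowerSeries.coeff 0 a = f := by
  rw [← ha, formalPicard, map_add, coeff_zero_formalPrimitive, PowerSeries.coeff_zero_C, add_zero]

lemma derivative_of_formalPicard_eq {f : smoothCircle} (ha : formalPicard p x₀ f a = a) :
    PowerSeries.derivative smoothCircle a = formalField p x₀ a := by
  conv_lhs => rw [← ha, formalPicard, map_add, derivative_formalPrimitive,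
    PowerSeries.derivative_C, zero_add]

end FormalSolution

/-! ### Double power series -/

section DoublePowerSeries

variable {𝕜 : Type*} [NontriviallyNormedField 𝕜]

/-- The multilinear map whose diagonal is the monomial `(h, t) ↦ h ^ i t ^ (m - i)`, for
`i ≤ m`. -/
def monomialMultilinear (𝕜 : Type*) [NontriviallyNormedField 𝕜] (m i : ℕ) :
    ContinuousMultilinearMap 𝕜 (fun _ : Fin m => 𝕜 × 𝕜) 𝕜 :=
  (ContinuousMultilinearMap.mkPiAlgebra 𝕜 (Fin m) 𝕜).compContinuousLinearMap
    fun l : Fin m => if (l : ℕ) < i then ContinuousLinearMap.fst 𝕜 𝕜 𝕜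
      else ContinuousLinearMap.snd 𝕜 𝕜 𝕜

lemma norm_monomialMultilinear_le (m i : ℕ) : ‖monomialMultilinear 𝕜 m i‖ ≤ 1 := by
  refine (ContinuousMultilinearMap.norm_compContinuousLinearMap_le _ _).trans ?_
  rw [ContinuousMultilinearMap.norm_mkPiAlgebra, one_mul]
  refine Finset.prod_le_one (fun _ _ => norm_nonneg _) fun l _ => ?_
  split_ifs
  · exact ContinuousLinearMap.norm_fst_le ..
  · exact ContinuousLinearMap.norm_snd_le ..

lemma monomialMultilinear_apply_diag (i j : ℕ) (y : 𝕜 × 𝕜) :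
    (monomialMultilinear 𝕜 (i + j) i fun _ => y) = y.1 ^ i * y.2 ^ j := by
  have hfactor (l : Fin (i + j)) : (if (l : ℕ) < i then ContinuousLinearMap.fst 𝕜 𝕜 𝕜
      else ContinuousLinearMap.snd 𝕜 𝕜 𝕜) y = if (l : ℕ) < i then y.1 else y.2 := by
    split_ifs <;> rfl
  simp only [monomialMultilinear, ContinuousMultilinearMap.compContinuousLinearMap_apply,
    ContinuousMultilinearMap.mkPiAlgebra_apply, hfactor]
  rw [Fin.prod_univ_add]
  simp

/-- The formal multilinear series in two variables of the double power series with
coefficients `c`. -/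
def doublePowerSeries (c : ℕ × ℕ → 𝕜) : FormalMultilinearSeries 𝕜 (𝕜 × 𝕜) 𝕜 :=
  fun m => ∑ ij ∈ antidiagonal m, c ij • monomialMultilinear 𝕜 m ij.1

lemma doublePowerSeries_apply_diag (c : ℕ × ℕ → 𝕜) (m : ℕ) (y : 𝕜 × 𝕜) :
    (doublePowerSeries c m fun _ => y) =
      ∑ ij ∈ antidiagonal m, c ij * (y.1 ^ ij.1 * y.2 ^ ij.2) := by
  rw [doublePowerSeries, _root_.sum_apply]
  refine Finset.sum_congr rfl fun ij hij => ?_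
  obtain rfl := mem_antidiagonal.1 hij
  rw [_root_.smul_apply, monomialMultilinear_apply_diag, smul_eq_mul]

lemma norm_doublePowerSeries_le (c : ℕ × ℕ → 𝕜) (m : ℕ) :
    ‖doublePowerSeries c m‖ ≤ ∑ ij ∈ antidiagonal m, ‖c ij‖ := by
  refine (norm_sum_le _ _).trans (Finset.sum_le_sum fun ij _ => ?_)
  rw [norm_smul]
  exact mul_le_of_le_one_right (norm_nonneg _) (norm_monomialMultilinear_le _ _)

lemma le_radius_doublePowerSeries {c : ℕ × ℕ → 𝕜} {r : ℝ≥0}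
    (hc : Summable fun ij : ℕ × ℕ => ‖c ij‖ * (r : ℝ) ^ (ij.1 + ij.2)) :
    r ≤ (doublePowerSeries c).radius := by
  refine FormalMultilinearSeries.le_radius_of_summable_norm _ <|
    (hasSum_sum_antidiagonal hc.hasSum).summable.of_nonneg_of_le (fun _ => by positivity)
      fun m => ?_
  refine (mul_le_mul_of_nonneg_right (norm_doublePowerSeries_le c m) (by positivity)).trans_eq ?_
  rw [Finset.sum_mul]
  exact Finset.sum_congr rfl fun ij hij => by rw [mem_antidiagonal.1 hij]

lemma hasFPowerSeriesOnBall_doublePowerSeries {c : ℕ × ℕ → 𝕜} {r : ℝ≥0} (hr : 0 < r)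
    (hc : Summable fun ij : ℕ × ℕ => ‖c ij‖ * (r : ℝ) ^ (ij.1 + ij.2)) {g : 𝕜 × 𝕜 → 𝕜} {q : 𝕜 × 𝕜}
    (hg : ∀ y : 𝕜 × 𝕜, ‖y‖ < r →
      HasSum (fun ij : ℕ × ℕ => c ij * (y.1 ^ ij.1 * y.2 ^ ij.2)) (g (q + y))) :
    HasFPowerSeriesOnBall g (doublePowerSeries c) q r where
  r_le := le_radius_doublePowerSeries hc
  r_pos := by exact_mod_cast hr
  hasSum {y} hy := by
    have hyr : ‖y‖ < r := by
      rw [mem_eball_zero_iff, enorm_eq_nnnorm, ENNReal.coe_lt_coe] at hy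
      exact_mod_cast hy
    simp only [doublePowerSeries_apply_diag]
    exact hasSum_sum_antidiagonal (hg y hyr)

end DoublePowerSeries

/-! ### Taylor series -/

lemma summable_of_tsum_enorm_ne_top {ι E : Type*} [NormedAddCommGroup E] [CompleteSpace E]
    {f : ι → E} (hf : ∑' i, ‖f i‖ₑ ≠ ⊤) : Summable f :=
  .of_norm <| by simpa using ENNReal.summable_toReal hf

section Taylor

variable {f : ℝ → ℝ} {r : ℝ≥0}

lemma enorm_taylorCoeff_mul_pow_le (n : ℕ) (f : ℝ → ℝ) (x : ℝ) {h : ℝ} (hh : ‖h‖ₑ ≤ r) :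
    ‖iteratedDeriv n f x / n ! * h ^ n‖ₑ ≤ taylorSup n f * (r : ℝ≥0∞) ^ n := by
  have hfact : (n ! : ℝ) ≠ 0 := by positivity
  rw [enorm_mul, enorm_pow, div_eq_mul_inv, enorm_mul, enorm_inv hfact, Real.enorm_natCast,
    ← div_eq_mul_inv]
  gcongr
  exact le_taylorSup n f x

lemma edist_taylor_le (hf : ContDiff ℝ ∞ f) (x : ℝ) {h : ℝ} (hh : ‖h‖ₑ ≤ r) (n : ℕ) :
    edist (∑ k ∈ Finset.range n, iteratedDeriv k f x / k ! * h ^ k) (f (x + h)) ≤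
      taylorSup n f * (r : ℝ≥0∞) ^ n := by
  rcases n with _ | n
  · rw [Finset.sum_range_zero, edist_comm, edist_eq_enorm_sub, sub_zero, pow_zero, mul_one]
    exact enorm_apply_le_taylorSup f (x + h)
  rcases eq_or_ne h 0 with rfl | hne
  · simp [Finset.sum_range_succ']
  have hx : x ≠ x + h := by simpa using hne
  have hcd (m : ℕ) : ContDiff ℝ m f := hf.of_le (by exact_mod_cast le_top)
  have htaylor : taylorWithinEval f n (uIcc x (x + h)) x (x + h) =
      ∑ k ∈ Finset.range (n + 1), iteratedDeriv k f x / k ! * h ^ k := by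
    rw [taylor_within_apply]
    refine Finset.sum_congr rfl fun k _ => ?_
    rw [iteratedDerivWithin_eq_iteratedDeriv (uniqueDiffOn_uIcc hx) (hcd k).contDiffAt
      left_mem_uIcc, add_sub_cancel_left, smul_eq_mul]
    ring
  obtain ⟨y, -, hy⟩ := taylor_mean_remainder_lagrange_iteratedDeriv hx
    (hcd (n + 1)).contDiffOn
  rw [add_sub_cancel_left, htaylor, mul_div_right_comm] at hy
  rw [edist_comm, edist_eq_enorm_sub, hy]
  exact enorm_taylorCoeff_mul_pow_le (n + 1) f y hh

lemma hasSum_taylor (hf : ContDiff ℝ ∞ f) (hr : ∑' n, taylorSup n f * (r : ℝ≥0∞) ^ n ≠ ⊤) (x : ℝ)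
    {h : ℝ} (hh : ‖h‖ₑ ≤ r) :
    HasSum (fun n => iteratedDeriv n f x / n ! * h ^ n) (f (x + h)) := by
  have hsum : Summable fun n => iteratedDeriv n f x / n ! * h ^ n :=
    summable_of_tsum_enorm_ne_top <| ne_top_of_le_ne_top hr <|
      ENNReal.tsum_le_tsum fun n => enorm_taylorCoeff_mul_pow_le n f x hh
  rw [hsum.hasSum_iff_tendsto_nat, tendsto_iff_edist_tendsto_0]
  exact tendsto_of_tendsto_of_tendsto_of_le_of_le tendsto_const_nhds
    (ENNReal.tendsto_atTop_zero_of_tsum_ne_top hr) (fun _ => zero_le) (edist_taylor_le hf x hh)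

end Taylor

/-! ### Cauchy estimates -/

section CauchyEstimates

variable {𝕜 E F : Type*} [NontriviallyNormedField 𝕜] [NormedAddCommGroup E] [NormedSpace 𝕜 E]
  [NormedAddCommGroup F] [NormedSpace 𝕜 F]

lemma exists_nnnorm_changeOrigin_mul_pow_le (q : FormalMultilinearSeries 𝕜 E F) {s : ℝ≥0}
    (hs : (s : ℝ≥0∞) + s < q.radius) :
    ∃ C : ℝ≥0, ∀ y : E, ‖y‖₊ ≤ s → ∀ n, ‖q.changeOrigin y n‖₊ * s ^ n ≤ C := by
  have hsum := NNReal.summable_sigma.1 (q.changeOriginSeries_summable_aux₁ hs)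
  refine ⟨∑' k : ℕ, ∑' c : Σ l : ℕ, { t : Finset (Fin (k + l)) // t.card = l },
    ‖q (k + c.1)‖₊ * s ^ c.1 * s ^ k, fun y hy n => ?_⟩
  have hlt : (s : ℝ≥0∞) < q.radius := le_self_add.trans_lt hs
  have hle (c : Σ l : ℕ, { t : Finset (Fin (n + l)) // t.card = l }) :
      ‖q (n + c.1)‖₊ * ‖y‖₊ ^ c.1 ≤ ‖q (n + c.1)‖₊ * s ^ c.1 := by gcongr
  have hs2 := q.changeOriginSeries_summable_aux₂ hlt n
  have hchange : ‖q.changeOrigin y n‖₊ ≤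
      ∑' c : Σ l : ℕ, { t : Finset (Fin (n + l)) // t.card = l }, ‖q (n + c.1)‖₊ * s ^ c.1 :=
    (q.nnnorm_changeOrigin_le n ((ENNReal.coe_le_coe.2 hy).trans_lt hlt)).trans
      ((NNReal.summable_of_le hle hs2).tsum_le_tsum hle hs2)
  refine (mul_le_mul_left hchange _).trans ?_
  rw [← NNReal.tsum_mul_right]
  exact hsum.2.le_tsum n fun _ _ => zero_le

variable [NormedSpace ℝ F] {f : ℝ → F}

lemma periodic_iteratedDeriv {f : ℝ → F} {c : ℝ} (hper : Function.Periodic f c) (n : ℕ) :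
    Function.Periodic (iteratedDeriv n f) c := fun x => by
  rw [← congr_fun (iteratedDeriv_comp_add_const n f c) x, hper.funext]

variable [CompleteSpace F]

lemma nnnorm_iteratedDeriv_le_of_hasFPowerSeriesOnBall
    {q : FormalMultilinearSeries ℝ ℝ F} {x : ℝ} {r : ℝ≥0∞} (h : HasFPowerSeriesOnBall f q x r)
    (n : ℕ) : ‖iteratedDeriv n f x‖₊ ≤ n ! * ‖q n‖₊ := by
  have hfact := h.factorial_smul 1 n
  rw [← iteratedDeriv_eq_iteratedFDeriv] at hfact
  rw [← hfact, ← Nat.cast_smul_eq_nsmul ℝ, nnnorm_smul, Real.nnnorm_natCast]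
  gcongr
  simpa using (q n).le_opNNNorm fun _ => 1

lemma exists_nhds_enorm_iteratedDeriv_le {z : ℝ} (hf : AnalyticAt ℝ f z) :
    ∃ U ∈ 𝓝 z, ∃ s C : ℝ≥0, 0 < s ∧
      ∀ x ∈ U, ∀ n : ℕ, ‖iteratedDeriv n f x‖ₑ / n ! * (s : ℝ≥0∞) ^ n ≤ C := by
  obtain ⟨q, r, hq⟩ := hf
  obtain ⟨r', hr'0, hr'⟩ := ENNReal.lt_iff_exists_nnreal_btwn.1 hq.r_pos
  have hs0 : 0 < r' / 2 := half_pos (by exact_mod_cast hr'0)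
  have hhalves : ((r' / 2 : ℝ≥0) : ℝ≥0∞) + (r' / 2 : ℝ≥0) = r' := by
    rw [← ENNReal.coe_add, add_halves]
  obtain ⟨C, hC⟩ := exists_nnnorm_changeOrigin_mul_pow_le q
    (hhalves.trans_lt (hr'.trans_le hq.r_le))
  refine ⟨Metric.closedBall z (r' / 2 : ℝ≥0), Metric.closedBall_mem_nhds z (by exact_mod_cast hs0),
    r' / 2, C, hs0, fun x hx n => ?_⟩
  have hxz : ‖x - z‖₊ ≤ r' / 2 := by rwa [mem_closedBall_iff_norm] at hx
  have hball := hq.changeOrigin (y := x - z)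
    ((ENNReal.coe_le_coe.2 hxz).trans_lt ((le_self_add.trans_eq hhalves).trans_lt hr'))
  rw [add_sub_cancel] at hball
  have hderiv : ‖iteratedDeriv n f x‖ₑ / n ! ≤ ‖q.changeOrigin (x - z) n‖₊ := by
    refine ENNReal.div_le_of_le_mul' ?_
    exact_mod_cast nnnorm_iteratedDeriv_le_of_hasFPowerSeriesOnBall hball n
  refine (mul_le_mul_left hderiv _).trans ?_
  exact_mod_cast hC (x - z) hxz n

lemma exists_enorm_iteratedDeriv_le_of_isCompact {K : Set ℝ} (hK : IsCompact K)
    (hf : AnalyticOnNhd ℝ f K) :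
    ∃ s C : ℝ≥0, 0 < s ∧
      ∀ x ∈ K, ∀ n : ℕ, ‖iteratedDeriv n f x‖ₑ / n ! * (s : ℝ≥0∞) ^ n ≤ C := by
  refine hK.induction_on (p := fun S => ∃ s C : ℝ≥0, 0 < s ∧
    ∀ x ∈ S, ∀ n : ℕ, ‖iteratedDeriv n f x‖ₑ / n ! * (s : ℝ≥0∞) ^ n ≤ C) ?_ ?_ ?_ ?_
  · exact ⟨1, 0, one_pos, by simp⟩
  · rintro S T hST ⟨s, C, hs, h⟩
    exact ⟨s, C, hs, fun x hx => h x (hST hx)⟩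
  · rintro S T ⟨s, C, hs, h⟩ ⟨s', C', hs', h'⟩
    refine ⟨min s s', max C C', lt_min hs hs', fun x hx n => ?_⟩
    have hmono {σ : ℝ≥0} (hσ : min s s' ≤ σ) :
        ‖iteratedDeriv n f x‖ₑ / n ! * ((min s s' : ℝ≥0) : ℝ≥0∞) ^ n ≤
          ‖iteratedDeriv n f x‖ₑ / n ! * (σ : ℝ≥0∞) ^ n := by gcongr
    rcases hx with hx | hx
    · exact (hmono (min_le_left _ _)).trans ((h x hx n).trans (by gcongr; exact le_max_left _ _))
    · exact (hmono (min_le_right _ _)).trans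
        ((h' x hx n).trans (by gcongr; exact le_max_right _ _))
  · intro z hz
    obtain ⟨U, hU, h⟩ := exists_nhds_enorm_iteratedDeriv_le (hf z hz)
    exact ⟨U, mem_nhdsWithin_of_mem_nhds hU, h⟩

lemma exists_taylorSup_mul_pow_le {c : ℝ} (hc : 0 < c) (hper : Function.Periodic f c)
    (hf : AnalyticOnNhd ℝ f univ) :
    ∃ s C : ℝ≥0, 0 < s ∧ ∀ n, taylorSup n f * (s : ℝ≥0∞) ^ n ≤ C := by
  obtain ⟨s, C, hs, h⟩ := exists_enorm_iteratedDeriv_le_of_isCompact (f := f)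
    (isCompact_Icc (a := 0) (b := c)) (hf.mono (subset_univ _))
  refine ⟨s, C, hs, fun n => ?_⟩
  rw [taylorSup, ENNReal.iSup_mul]
  refine iSup_le fun x => ?_
  obtain ⟨y, hy, hxy⟩ := (periodic_iteratedDeriv hper n).exists_mem_Ico₀ hc x
  rw [hxy]
  exact h y (Ico_subset_Icc_self hy) n

lemma exists_tsum_taylorSup_mul_pow_ne_top {c : ℝ} (hc : 0 < c) (hper : Function.Periodic f c)
    (hf : AnalyticOnNhd ℝ f univ) :
    ∃ r : ℝ≥0, 0 < r ∧ ∀ R ≤ r, ∑' n, taylorSup n f * (R : ℝ≥0∞) ^ n ≠ ⊤ := by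
  obtain ⟨s, C, hs, hC⟩ := exists_taylorSup_mul_pow_le hc hper hf
  refine ⟨s / 2, by positivity, fun R hR => ?_⟩
  have hgeom : ∑' n : ℕ, ((C * (1 / 2) ^ n : ℝ≥0) : ℝ≥0∞) ≠ ⊤ :=
    ENNReal.tsum_coe_ne_top_iff_summable.2
      ((NNReal.summable_geometric (by norm_num)).mul_left C)
  refine ne_top_of_le_ne_top hgeom (ENNReal.tsum_le_tsum fun n => ?_)
  calc taylorSup n f * (R : ℝ≥0∞) ^ n
      ≤ taylorSup n f * ((s * (1 / 2) : ℝ≥0) : ℝ≥0∞) ^ n := by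
        gcongr
        exact hR.trans_eq (by rw [mul_one_div])
    _ = taylorSup n f * (s : ℝ≥0∞) ^ n * ((1 / 2 : ℝ≥0) : ℝ≥0∞) ^ n := by
        rw [ENNReal.coe_mul, mul_pow, mul_assoc]
    _ ≤ ((C * (1 / 2) ^ n : ℝ≥0) : ℝ≥0∞) := by
        rw [ENNReal.coe_mul, ENNReal.coe_pow]
        gcongr
        exact hC n

end CauchyEstimates

/-! ### The sum of a power series in time -/

/-- The function of space and time to which a power series in time sums up. -/
def evalSeries (a : smoothCircle⟦X⟧) (x t : ℝ) : ℝ :=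
  ∑' k, (PowerSeries.coeff k a).1 x * t ^ k

lemma evalSeries_smul (c : ℝ) (a : smoothCircle⟦X⟧) (x t : ℝ) :
    evalSeries (c • a) x t = c * evalSeries a x t := by
  simp only [evalSeries, PowerSeries.coeff_smul, SetLike.val_smul, Pi.smul_apply, smul_eq_mul,
    mul_assoc, tsum_mul_left]

lemma evalSeries_neg (a : smoothCircle⟦X⟧) (x t : ℝ) :
    evalSeries (-a) x t = -evalSeries a x t := by
  rw [← neg_one_smul ℝ a, evalSeries_smul, neg_one_mul]

lemma evalSeries_one (x t : ℝ) : evalSeries 1 x t = 1 := by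
  rw [evalSeries, tsum_eq_single 0 fun k hk => by simp [PowerSeries.coeff_one, hk]]
  simp

lemma evalSeries_zero_time (a : smoothCircle⟦X⟧) (x : ℝ) :
    evalSeries a x 0 = (PowerSeries.coeff 0 a).1 x := by
  rw [evalSeries, tsum_eq_single 0 fun k hk => by simp [hk]]
  simp

lemma periodic_evalSeries (a : smoothCircle⟦X⟧) (t : ℝ) :
    Function.Periodic (fun x => evalSeries a x t) 1 := fun x =>
  tsum_congr fun k => by rw [periodic_coe (PowerSeries.coeff k a) x]

lemma weight_le_weight_left {R R' : ℝ≥0} (h : R ≤ R') (ρ : ℝ≥0) (n k : ℕ) :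
    weight R ρ n k ≤ weight R' ρ n k := by
  rw [weight, weight]
  gcongr

lemma seriesNorm_mono_left {R R' : ℝ≥0} (h : R ≤ R') (ρ : ℝ≥0) (a : smoothCircle⟦X⟧) :
    seriesNorm R ρ a ≤ seriesNorm R' ρ a :=
  ENNReal.tsum_le_tsum fun k => ENNReal.tsum_le_tsum fun n => by
    gcongr
    exact weight_le_weight_left h ρ n k

lemma seriesNorm_zero_left (ρ : ℝ≥0) (a : smoothCircle⟦X⟧) :
    seriesNorm 0 ρ a = ∑' k, taylorSup 0 (PowerSeries.coeff k a).1 * (ρ : ℝ≥0∞) ^ k := by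
  refine tsum_congr fun k => ?_
  rw [tsum_eq_single 0 fun n hn => by simp [weight, hn]]
  simp [weight]

section NormalConvergence

variable {ρ : ℝ≥0} {a b : smoothCircle⟦X⟧} {t : ℝ}

lemma summable_taylorSup_zero_mul_pow (ha : seriesNorm 0 ρ a ≠ ⊤) :
    Summable fun k => (taylorSup 0 (PowerSeries.coeff k a).1 * (ρ : ℝ≥0∞) ^ k).toReal :=
  ENNReal.summable_toReal (seriesNorm_zero_left ρ a ▸ ha)

lemma norm_coeff_mul_pow_le (ha : seriesNorm 0 ρ a ≠ ⊤) (ht : |t| ≤ ρ) (k : ℕ) (x : ℝ) :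
    ‖(PowerSeries.coeff k a).1 x * t ^ k‖ ≤
      (taylorSup 0 (PowerSeries.coeff k a).1 * (ρ : ℝ≥0∞) ^ k).toReal := by
  have ht' : ‖t‖ₑ ≤ ρ := by
    rw [enorm_le_coe]
    exact_mod_cast ht
  rw [← toReal_enorm, enorm_mul, enorm_pow]
  refine ENNReal.toReal_mono (ENNReal.ne_top_of_tsum_ne_top (seriesNorm_zero_left ρ a ▸ ha) k) ?_
  gcongr
  exact enorm_apply_le_taylorSup _ x

lemma summable_norm_coeff_mul_pow (ha : seriesNorm 0 ρ a ≠ ⊤) (ht : |t| ≤ ρ) (x : ℝ) :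
    Summable fun k => ‖(PowerSeries.coeff k a).1 x * t ^ k‖ :=
  (summable_taylorSup_zero_mul_pow ha).of_nonneg_of_le (fun _ => norm_nonneg _)
    fun k => norm_coeff_mul_pow_le ha ht k x

lemma continuous_evalSeries (ha : seriesNorm 0 ρ a ≠ ⊤) (ht : |t| ≤ ρ) :
    Continuous fun x => evalSeries a x t :=
  continuous_tsum (fun _ => (continuous_coe _).mul continuous_const)
    (summable_taylorSup_zero_mul_pow ha) fun k x => norm_coeff_mul_pow_le ha ht k x

lemma evalSeries_add (ha : seriesNorm 0 ρ a ≠ ⊤) (hb : seriesNorm 0 ρ b ≠ ⊤) (ht : |t| ≤ ρ)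
    (x : ℝ) : evalSeries (a + b) x t = evalSeries a x t + evalSeries b x t := by
  rw [evalSeries, evalSeries, evalSeries, ← (summable_norm_coeff_mul_pow ha ht x).of_norm.tsum_add
    (summable_norm_coeff_mul_pow hb ht x).of_norm]
  refine tsum_congr fun k => ?_
  rw [map_add, ← add_mul]
  rfl

lemma evalSeries_mul (ha : seriesNorm 0 ρ a ≠ ⊤) (hb : seriesNorm 0 ρ b ≠ ⊤) (ht : |t| ≤ ρ)
    (x : ℝ) : evalSeries (a * b) x t = evalSeries a x t * evalSeries b x t := by
  rw [evalSeries, evalSeries, evalSeries,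
    tsum_mul_tsum_eq_tsum_sum_antidiagonal_of_summable_norm (summable_norm_coeff_mul_pow ha ht x)
      (summable_norm_coeff_mul_pow hb ht x)]
  refine tsum_congr fun k => ?_
  rw [PowerSeries.coeff_mul, AddSubmonoidClass.coe_finsetSum, Finset.sum_apply, Finset.sum_mul]
  refine Finset.sum_congr rfl fun ij hij => ?_
  rw [← mem_antidiagonal.1 hij, pow_add, MulMemClass.coe_mul, Pi.mul_apply, mul_mul_mul_comm]

lemma seriesNorm_mul_ne_top {R : ℝ≥0} (ha : seriesNorm R ρ a ≠ ⊤) (hb : seriesNorm R ρ b ≠ ⊤) :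
    seriesNorm R ρ (a * b) ≠ ⊤ :=
  ne_top_of_le_ne_top (by finiteness) (seriesNorm_mul_le R ρ a b)

lemma seriesNorm_pow_ne_top {R : ℝ≥0} (ha : seriesNorm R ρ a ≠ ⊤) (n : ℕ) :
    seriesNorm R ρ (a ^ n) ≠ ⊤ :=
  ne_top_of_le_ne_top (by finiteness) (seriesNorm_pow_le R ρ a n)

lemma seriesNorm_coeffwise_invDerivₗ_ne_top {R : ℝ≥0} (ha : seriesNorm R ρ a ≠ ⊤) (x₀ : ℝ) :
    seriesNorm R ρ (coeffwise (invDerivₗ x₀) a) ≠ ⊤ :=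
  ne_top_of_le_ne_top (by finiteness) (seriesNorm_coeffwise_invDerivₗ_le R ρ a x₀)

lemma evalSeries_pow (ha : seriesNorm 0 ρ a ≠ ⊤) (n : ℕ) (ht : |t| ≤ ρ) (x : ℝ) :
    evalSeries (a ^ n) x t = evalSeries a x t ^ n := by
  induction n with
  | zero => rw [pow_zero, pow_zero, evalSeries_one]
  | succ n ih => rw [pow_succ, pow_succ, evalSeries_mul (seriesNorm_pow_ne_top ha n) ha ht, ih]

lemma hasDerivAt_evalSeries_space (ha : seriesNorm 0 ρ a ≠ ⊤)
    (hda : seriesNorm 0 ρ (coeffwise derivₗ a) ≠ ⊤) (ht : |t| ≤ ρ) (x : ℝ) :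
    HasDerivAt (fun y => evalSeries a y t) (evalSeries (coeffwise derivₗ a) x t) x := by
  refine hasDerivAt_tsum (summable_taylorSup_zero_mul_pow hda) (fun k y => ?_)
    (fun k y => norm_coeff_mul_pow_le hda ht k y) (summable_norm_coeff_mul_pow ha ht 0).of_norm x
  rw [coeff_coeffwise]
  exact (differentiable_coe (PowerSeries.coeff k a) y).hasDerivAt.mul_const _

lemma hasDerivAt_evalSeries_time (ha : seriesNorm 0 ρ a ≠ ⊤)
    (hda : seriesNorm 0 ρ (PowerSeries.derivative smoothCircle a) ≠ ⊤) (ht : |t| < ρ) (x : ℝ) :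
    HasDerivAt (evalSeries a x) (evalSeries (PowerSeries.derivative smoothCircle a) x t) t := by
  have htail : HasDerivAt (fun τ => ∑' k, (PowerSeries.coeff (k + 1) a).1 x * τ ^ (k + 1))
      (evalSeries (PowerSeries.derivative smoothCircle a) x t) t := by
    refine hasDerivAt_tsum_of_isPreconnected (summable_taylorSup_zero_mul_pow hda)
      isOpen_Ioo isPreconnected_Ioo (fun k τ _ => ?_)
      (fun k τ hτ => norm_coeff_mul_pow_le hda (abs_lt.2 hτ).le k x) (abs_lt.1 ht)
      ((summable_nat_add_iff 1).2 (summable_norm_coeff_mul_pow ha ht.le x).of_norm) (abs_lt.1 ht)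
    refine ((hasDerivAt_pow (k + 1) τ).const_mul _).congr_deriv ?_
    simp [PowerSeries.coeff_derivative, mul_assoc]
  refine (htail.const_add ((PowerSeries.coeff 0 a).1 x)).congr_of_eventuallyEq ?_
  filter_upwards [isOpen_Ioo.mem_nhds (abs_lt.1 ht)] with τ hτ
  rw [evalSeries, (summable_norm_coeff_mul_pow ha (abs_lt.2 hτ).le x).of_norm.tsum_eq_zero_add,
    pow_zero, mul_one]

lemma evalSeries_coeffwise_invDerivₗ (ha : seriesNorm 0 ρ a ≠ ⊤) (x₀ : ℝ) (ht : |t| ≤ ρ) (x : ℝ) :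
    evalSeries (coeffwise (invDerivₗ x₀) a) x t = invDeriv x₀ (fun y => evalSeries a y t) x := by
  set S : ℕ → smoothCircle := fun N => ∑ k ∈ Finset.range N, t ^ k • PowerSeries.coeff k a with hS
  have hSapply (N : ℕ) (y : ℝ) : (S N : ℝ → ℝ) y =
      ∑ k ∈ Finset.range N, (PowerSeries.coeff k a).1 y * t ^ k := by
    simp [hS, mul_comm]
  have hIS (N : ℕ) : invDeriv x₀ (S N : ℝ → ℝ) x =
      ∑ k ∈ Finset.range N, (PowerSeries.coeff k (coeffwise (invDerivₗ x₀) a)).1 x * t ^ k := by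
    rw [← coe_invDerivₗ]
    simp [hS, mul_comm]
  have hunif : TendstoUniformly (fun N => (S N : ℝ → ℝ)) (fun y => evalSeries a y t) atTop := by
    simp only [funext (hSapply _)]
    exact tendstoUniformly_tsum_nat (summable_taylorSup_zero_mul_pow ha)
      fun k y => norm_coeff_mul_pow_le ha ht k y
  have hlim := tendsto_invDeriv (fun N => continuous_coe (S N)) (fun N => periodic_coe (S N))
    (continuous_evalSeries ha ht) (periodic_evalSeries a t) hunif x₀ x
  simp only [hIS] at hlim
  exact tendsto_nhds_unique (summable_norm_coeff_mul_pow
    (seriesNorm_coeffwise_invDerivₗ_ne_top ha x₀) ht x).of_norm.hasSum.tendsto_sum_nat hlim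

end NormalConvergence

/-! ### Analyticity of the sum -/

section Analyticity

variable {R ρ : ℝ≥0} {a : smoothCircle⟦X⟧} {h t : ℝ}

lemma enorm_taylorCoeff_mul_le (a : smoothCircle⟦X⟧) (hh : ‖h‖ₑ ≤ (R / 2 : ℝ≥0))
    (ht : ‖t‖ₑ ≤ (ρ / 2 : ℝ≥0)) (x : ℝ) (n k : ℕ) :
    ‖iteratedDeriv n (PowerSeries.coeff k a).1 x / n ! * (h ^ n * t ^ k)‖ₑ ≤
      taylorSup n (PowerSeries.coeff k a).1 * weight R ρ n k := by
  rw [← mul_assoc, enorm_mul, enorm_pow]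
  refine (mul_le_mul' (enorm_taylorCoeff_mul_pow_le n _ x hh) (pow_le_pow_left' ht k)).trans ?_
  rw [mul_assoc]
  gcongr
  exact_mod_cast le_weight R ρ n k

lemma summable_taylorCoeff_mul (ha : seriesNorm R ρ a ≠ ⊤) (hh : ‖h‖ₑ ≤ (R / 2 : ℝ≥0))
    (ht : ‖t‖ₑ ≤ (ρ / 2 : ℝ≥0)) (x : ℝ) :
    Summable fun nk : ℕ × ℕ =>
      iteratedDeriv nk.1 (PowerSeries.coeff nk.2 a).1 x / nk.1 ! * (h ^ nk.1 * t ^ nk.2) := by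
  refine summable_of_tsum_enorm_ne_top (ne_top_of_le_ne_top ha ?_)
  rw [← (Equiv.prodComm ℕ ℕ).tsum_eq, ENNReal.tsum_prod']
  exact ENNReal.tsum_le_tsum fun k => ENNReal.tsum_le_tsum fun n =>
    enorm_taylorCoeff_mul_le a hh ht x n k

lemma tsum_taylorSup_coeff_ne_top (hρ : ρ ≠ 0) (ha : seriesNorm R ρ a ≠ ⊤) (k : ℕ) :
    ∑' n, taylorSup n (PowerSeries.coeff k a).1 * ((R / 2 : ℝ≥0) : ℝ≥0∞) ^ n ≠ ⊤ := by
  have hpow : ((ρ / 2 : ℝ≥0) : ℝ≥0∞) ^ k ≠ 0 := by simp [hρ]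
  have hle : (∑' n, taylorSup n (PowerSeries.coeff k a).1 * ((R / 2 : ℝ≥0) : ℝ≥0∞) ^ n) *
      ((ρ / 2 : ℝ≥0) : ℝ≥0∞) ^ k ≤
        ∑' n, taylorSup n (PowerSeries.coeff k a).1 * weight R ρ n k := by
    rw [← ENNReal.tsum_mul_right]
    refine ENNReal.tsum_le_tsum fun n => ?_
    rw [mul_assoc]
    gcongr
    exact_mod_cast le_weight R ρ n k
  exact (ENNReal.lt_top_of_mul_ne_top_left
    (ne_top_of_le_ne_top (ENNReal.ne_top_of_tsum_ne_top ha k) hle) hpow).ne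

lemma hasSum_evalSeries (hρ : ρ ≠ 0) (ha : seriesNorm R ρ a ≠ ⊤) (hh : ‖h‖ₑ ≤ (R / 2 : ℝ≥0))
    (ht : ‖t‖ₑ ≤ (ρ / 2 : ℝ≥0)) (x : ℝ) :
    HasSum (fun nk : ℕ × ℕ =>
      iteratedDeriv nk.1 (PowerSeries.coeff nk.2 a).1 x / nk.1 ! * (h ^ nk.1 * t ^ nk.2))
      (evalSeries a (x + h) t) := by
  have hsum := ((Equiv.prodComm ℕ ℕ).hasSum_iff.2 (summable_taylorCoeff_mul ha hh ht x).hasSum)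
  have hfiber (k : ℕ) := ((hasSum_taylor (contDiff_coe _) (tsum_taylorSup_coeff_ne_top hρ ha k) x
    hh).mul_right (t ^ k))
  simp only [mul_assoc] at hfiber
  rw [evalSeries, (hsum.prod_fiberwise hfiber).tsum_eq]
  exact (summable_taylorCoeff_mul ha hh ht x).hasSum

lemma analyticOnNhd_evalSeries (hρ : ρ ≠ 0) (ha : seriesNorm R ρ a ≠ ⊤) {ε : ℝ≥0} (hε : 0 < ε)
    (hεR : ε ≤ R / 2) (hερ : ε ≤ ρ / 2) :
    AnalyticOnNhd ℝ (fun q : ℝ × ℝ => evalSeries a q.1 q.2) (univ ×ˢ Ioo (-(ε : ℝ)) ε) := by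
  rintro ⟨x, t⟩ ⟨-, ht⟩
  have henorm {s : ℝ} {r : ℝ≥0} (hs : ‖s‖ ≤ ε) (hr : ε ≤ r) : ‖s‖ₑ ≤ r := by
    rw [enorm_le_coe]
    exact le_trans (by exact_mod_cast hs) hr
  have hε' : ‖(ε : ℝ)‖ ≤ ε := by simp
  have hball : HasFPowerSeriesOnBall (fun q : ℝ × ℝ => evalSeries a q.1 q.2)
      (doublePowerSeries fun nk => iteratedDeriv nk.1 (PowerSeries.coeff nk.2 a).1 x / nk.1 !)
      (x, 0) ε := by
    refine hasFPowerSeriesOnBall_doublePowerSeries hε ?_ fun y hy => ?_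
    · convert (summable_taylorCoeff_mul ha (henorm hε' hεR) (henorm hε' hερ) x).norm using 2 with nk
      rw [norm_mul, pow_add]
      simp
    · simpa using hasSum_evalSeries hρ ha (henorm ((norm_fst_le y).trans hy.le) hεR)
        (henorm ((norm_snd_le y).trans hy.le) hερ) x
  refine hball.analyticAt_of_mem ?_
  rw [Metric.mem_eball, Prod.edist_eq, edist_self, max_eq_right zero_le, edist_dist, Real.dist_eq,
    sub_zero]
  exact (ENNReal.ofReal_lt_coe_iff (by positivity)).2 (abs_lt.2 ht)

end Analyticity

/-! ### Existence -/

section Existence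

variable {p : ℕ} {x₀ : ℝ} {R ρ : ℝ≥0} {a : smoothCircle⟦X⟧} {t : ℝ}

lemma seriesNorm_formalField_ne_top (ha : seriesNorm R ρ a ≠ ⊤)
    (hda : seriesNorm R ρ (coeffwise derivₗ a) ≠ ⊤) : seriesNorm R ρ (formalField p x₀ a) ≠ ⊤ := by
  have htransport := seriesNorm_mul_ne_top (seriesNorm_pow_ne_top ha p) hda
  have hnonlocal := seriesNorm_coeffwise_invDerivₗ_ne_top
    (seriesNorm_mul_ne_top (seriesNorm_pow_ne_top ha (p - 1)) (seriesNorm_mul_ne_top hda hda)) x₀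
  refine ne_top_of_le_ne_top ?_ (seriesNorm_add_le R ρ _ _)
  rw [seriesNorm_neg, seriesNorm_smul]
  finiteness

lemma evalSeries_quadratic (ha : seriesNorm 0 ρ a ≠ ⊤)
    (hda : seriesNorm 0 ρ (coeffwise derivₗ a) ≠ ⊤) (ht : |t| ≤ ρ) (y : ℝ) :
    p * evalSeries (a ^ (p - 1) * (coeffwise derivₗ a * coeffwise derivₗ a)) y t =
      deriv (fun z => evalSeries a z t ^ p) y * deriv (fun z => evalSeries a z t) y := by
  have hspace := hasDerivAt_evalSeries_space ha hda ht y
  rw [(hspace.fun_pow p).deriv, hspace.deriv, evalSeries_mul (seriesNorm_pow_ne_top ha _)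
    (seriesNorm_mul_ne_top hda hda) ht, evalSeries_mul hda hda ht, evalSeries_pow ha _ ht]
  ring

lemma evalSeries_formalField (ha : seriesNorm 0 ρ a ≠ ⊤)
    (hda : seriesNorm 0 ρ (coeffwise derivₗ a) ≠ ⊤) (ht : |t| ≤ ρ) (x : ℝ) :
    evalSeries (formalField p x₀ a) x t =
      -(evalSeries a x t ^ p * deriv (fun y => evalSeries a y t) x) +
        (1 / 2) * invDeriv x₀ (fun y =>
          deriv (fun z => evalSeries a z t ^ p) y * deriv (fun z => evalSeries a z t) y) x := by
  have htransport := seriesNorm_mul_ne_top (seriesNorm_pow_ne_top ha p) hda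
  have hquadratic := seriesNorm_mul_ne_top (seriesNorm_pow_ne_top ha (p - 1))
    (seriesNorm_mul_ne_top hda hda)
  have hnonlocal := seriesNorm_coeffwise_invDerivₗ_ne_top hquadratic x₀
  have hscaled : (fun y => deriv (fun z => evalSeries a z t ^ p) y *
      deriv (fun z => evalSeries a z t) y) = (p : ℝ) • fun y =>
        evalSeries (a ^ (p - 1) * (coeffwise derivₗ a * coeffwise derivₗ a)) y t :=
    funext fun y => (evalSeries_quadratic ha hda ht y).symm
  rw [formalField, evalSeries_add (by rwa [seriesNorm_neg])
      (by rw [seriesNorm_smul]; finiteness) ht, evalSeries_neg, evalSeries_smul,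
    evalSeries_mul (seriesNorm_pow_ne_top ha p) hda ht, evalSeries_pow ha p ht,
    (hasDerivAt_evalSeries_space ha hda ht x).deriv, hscaled, invDeriv_smul, Pi.smul_apply,
    evalSeries_coeffwise_invDerivₗ hquadratic x₀ ht, smul_eq_mul]
  ring

lemma isAnalyticSolution_evalSeries {f : smoothCircle} (hfix : formalPicard p x₀ f a = a)
    (hρ : ρ ≠ 0) (ha : seriesNorm R ρ a ≠ ⊤) (hda : seriesNorm R ρ (coeffwise derivₗ a) ≠ ⊤)
    {ε : ℝ≥0} (hε : 0 < ε) (hεR : ε ≤ R / 2) (hερ : ε ≤ ρ / 2) :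
    IsAnalyticSolution p x₀ f ε (evalSeries a) where
  periodic t _ := periodic_evalSeries a t
  analytic := analyticOnNhd_evalSeries hρ ha hε hεR hερ
  initial x := by rw [evalSeries_zero_time, coeff_zero_of_formalPicard_eq p x₀ hfix]
  equation x t ht := by
    have hερ' : (ε : ℝ) ≤ ρ := by exact_mod_cast hερ.trans (half_le_self zero_le)
    have ht' : |t| < ρ := (abs_lt.2 ht).trans_le hερ'
    have ha₀ := ne_top_of_le_ne_top ha (seriesNorm_mono_left zero_le ρ a)
    have hda₀ := ne_top_of_le_ne_top hda (seriesNorm_mono_left zero_le ρ _)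
    have htime := hasDerivAt_evalSeries_time ha₀ (by
      rw [derivative_of_formalPicard_eq p x₀ hfix]
      exact seriesNorm_formalField_ne_top ha₀ hda₀) ht' x
    rw [htime.deriv, derivative_of_formalPicard_eq p x₀ hfix,
      evalSeries_formalField ha₀ hda₀ ht'.le]
    ring

end Existence

lemma exists_isAnalyticSolution (p : ℕ) (x₀ : ℝ) {u₀ : ℝ → ℝ} (hper : Function.Periodic u₀ 1)
    (han : AnalyticOnNhd ℝ u₀ univ) :
    ∃ ε : ℝ, 0 < ε ∧ ∃ u : ℝ → ℝ → ℝ, IsAnalyticSolution p x₀ u₀ ε u := by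
  let f : smoothCircle := ⟨u₀, han.contDiff, hper⟩
  obtain ⟨r, hr, hf⟩ := exists_tsum_taylorSup_mul_pow_ne_top one_pos hper han
  obtain ⟨r', hr', hdf⟩ :=
    exists_tsum_taylorSup_mul_pow_ne_top one_pos (periodic_deriv hper) han.deriv
  have hR : 0 < min r r' := lt_min hr hr'
  obtain ⟨a, ρ, hfix, hρ, ha, hda⟩ := exists_formalPicard_fixedPoint p x₀ (f := f) hR.ne'
    (hf _ (min_le_left r r')) (hdf _ (min_le_right r r'))
  have hε : 0 < min (min r r' / 2) (ρ / 2) := lt_min (half_pos hR) (half_pos hρ)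
  exact ⟨(min (min r r' / 2) (ρ / 2) : ℝ≥0), by exact_mod_cast hε, evalSeries a,
    isAnalyticSolution_evalSeries hfix hρ.ne' ha hda hε (min_le_left _ _) (min_le_right _ _)⟩

/-! ### Real-analytic functions on the cylinder -/

/-- The space-time strip `ℝ × (-ε, ε)`, the universal cover of `𝕋 × (-ε, ε)`. -/
def strip (ε : ℝ) : Set (ℝ × ℝ) := univ ×ˢ Ioo (-ε) ε

/-- The partial derivative in time, the second coordinate. -/
def timeD (W : ℝ × ℝ → ℝ) (q : ℝ × ℝ) : ℝ := fderiv ℝ W q (0, 1)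

/-- The partial derivative in space, the first coordinate. -/
def spaceD (W : ℝ × ℝ → ℝ) (q : ℝ × ℝ) : ℝ := fderiv ℝ W q (1, 0)

/-- `W` is a real-analytic function on the cylinder `𝕋 × (-ε, ε)`, seen as a function on the
strip that is periodic in space. -/
structure IsAnalyticOnCylinder (ε : ℝ) (W : ℝ × ℝ → ℝ) : Prop where
  analyticOnNhd : AnalyticOnNhd ℝ W (strip ε)
  periodic : ∀ t ∈ Ioo (-ε) ε, Function.Periodic (fun x => W (x, t)) 1

/-- The filter of the limits `t → 0` that are uniform in `x`. -/
def timeToZero : Filter (ℝ × ℝ) := comap Prod.snd (𝓝 0)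

lemma mem_strip {ε x t : ℝ} : (x, t) ∈ strip ε ↔ t ∈ Ioo (-ε) ε := by simp [strip]

lemma zero_mem_Ioo_neg {ε : ℝ} (hε : 0 < ε) : (0 : ℝ) ∈ Ioo (-ε) ε := ⟨neg_lt_zero.2 hε, hε⟩

lemma strip_mem_timeToZero {ε : ℝ} (hε : 0 < ε) : strip ε ∈ timeToZero :=
  mem_comap.2 ⟨_, isOpen_Ioo.mem_nhds (zero_mem_Ioo_neg hε), fun _ hq => mem_strip.2 hq⟩

lemma tendsto_timeToZero (x : ℝ) : Tendsto (fun t : ℝ => (x, t)) (𝓝 0) timeToZero :=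
  tendsto_comap_iff.2 tendsto_id

lemma eventually_timeToZero {P : ℝ × ℝ → Prop} :
    (∀ᶠ q in timeToZero, P q) ↔ ∃ δ > 0, ∀ x t, |t| < δ → P (x, t) := by
  simp only [timeToZero, eventually_comap, Metric.eventually_nhds_iff, Prod.forall,
    Real.dist_0_eq_abs]
  exact exists_congr fun δ => and_congr_right fun _ =>
    ⟨fun h x t ht => h ht x t rfl, fun h _ ht x t ht' => h x t (ht' ▸ ht)⟩

namespace IsAnalyticOnCylinder

variable {ε t : ℝ} {V W : ℝ × ℝ → ℝ} {k : ℕ}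

lemma hasDerivAt_time (hW : IsAnalyticOnCylinder ε W) (x : ℝ) (ht : t ∈ Ioo (-ε) ε) :
    HasDerivAt (fun τ => W (x, τ)) (timeD W (x, t)) t :=
  (hW.analyticOnNhd _ (mem_strip.2 ht)).differentiableAt.hasFDerivAt.comp_hasDerivAt t
    ((hasDerivAt_const t x).prodMk (hasDerivAt_id t))

lemma hasDerivAt_space (hW : IsAnalyticOnCylinder ε W) (x : ℝ) (ht : t ∈ Ioo (-ε) ε) :
    HasDerivAt (fun y => W (y, t)) (spaceD W (x, t)) x :=
  (hW.analyticOnNhd _ (mem_strip.2 ht)).differentiableAt.hasFDerivAt.comp_hasDerivAt x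
    ((hasDerivAt_id x).prodMk (hasDerivAt_const x t))

lemma analyticAt_slice (hW : IsAnalyticOnCylinder ε W) (x : ℝ) (ht : t ∈ Ioo (-ε) ε) :
    AnalyticAt ℝ (fun τ => W (x, τ)) t :=
  (hW.analyticOnNhd (x, t) (mem_strip.2 ht)).comp (analyticAt_const.prod analyticAt_id)

lemma continuous_slice (hW : IsAnalyticOnCylinder ε W) (ht : t ∈ Ioo (-ε) ε) :
    Continuous fun x => W (x, t) :=
  hW.analyticOnNhd.continuousOn.comp_continuous (by fun_prop) fun _ => mem_strip.2 ht

protected lemma sub (hV : IsAnalyticOnCylinder ε V) (hW : IsAnalyticOnCylinder ε W) :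
    IsAnalyticOnCylinder ε (V - W) where
  analyticOnNhd := hV.analyticOnNhd.sub hW.analyticOnNhd
  periodic t ht := (hV.periodic t ht).sub (hW.periodic t ht)

protected lemma mul (hV : IsAnalyticOnCylinder ε V) (hW : IsAnalyticOnCylinder ε W) :
    IsAnalyticOnCylinder ε (V * W) where
  analyticOnNhd := hV.analyticOnNhd.mul hW.analyticOnNhd
  periodic t ht := (hV.periodic t ht).mul (hW.periodic t ht)

protected lemma pow (hW : IsAnalyticOnCylinder ε W) (n : ℕ) : IsAnalyticOnCylinder ε (W ^ n) where
  analyticOnNhd := hW.analyticOnNhd.pow n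
  periodic t ht x := congrArg (· ^ n) (hW.periodic t ht x)

protected lemma timeD (hW : IsAnalyticOnCylinder ε W) : IsAnalyticOnCylinder ε (timeD W) where
  analyticOnNhd :=
    (ContinuousLinearMap.apply ℝ ℝ ((0, 1) : ℝ × ℝ)).comp_analyticOnNhd hW.analyticOnNhd.fderiv
  periodic t ht x := by
    refine ((hW.hasDerivAt_time (x + 1) ht).congr_of_eventuallyEq ?_).unique
      (hW.hasDerivAt_time x ht)
    filter_upwards [isOpen_Ioo.mem_nhds ht] with τ hτ
    exact (hW.periodic τ hτ x).symm

protected lemma spaceD (hW : IsAnalyticOnCylinder ε W) : IsAnalyticOnCylinder ε (spaceD W) where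
  analyticOnNhd :=
    (ContinuousLinearMap.apply ℝ ℝ ((1, 0) : ℝ × ℝ)).comp_analyticOnNhd hW.analyticOnNhd.fderiv
  periodic t ht := by
    rw [← funext fun x => (hW.hasDerivAt_space x ht).deriv]
    exact periodic_deriv (hW.periodic t ht)

lemma timeD_spaceD (hW : IsAnalyticOnCylinder ε W) {q : ℝ × ℝ} (hq : q ∈ strip ε) :
    timeD (spaceD W) q = spaceD (timeD W) q := by
  have hd : DifferentiableAt ℝ (fderiv ℝ W) q := (hW.analyticOnNhd.fderiv q hq).differentiableAt
  have hsecond (v w : ℝ × ℝ) :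
      fderiv ℝ (fun q' => fderiv ℝ W q' v) q w = fderiv ℝ (fderiv ℝ W) q w v := by
    simp [fderiv_clm_apply hd (differentiableAt_const v)]
  have hsymm : IsSymmSndFDerivAt ℝ W q :=
    (hW.analyticOnNhd q hq).contDiffAt.isSymmSndFDerivAt (n := 2) (by simp)
  exact (hsecond _ _).trans ((hsymm.eq _ _).trans (hsecond _ _).symm)

lemma timeD_sub (hV : IsAnalyticOnCylinder ε V) (hW : IsAnalyticOnCylinder ε W) {q : ℝ × ℝ}
    (hq : q ∈ strip ε) : timeD (V - W) q = timeD V q - timeD W q := by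
  simp [timeD, fderiv_sub (hV.analyticOnNhd q hq).differentiableAt
    (hW.analyticOnNhd q hq).differentiableAt]

lemma spaceD_sub (hV : IsAnalyticOnCylinder ε V) (hW : IsAnalyticOnCylinder ε W) {q : ℝ × ℝ}
    (hq : q ∈ strip ε) : spaceD (V - W) q = spaceD V q - spaceD W q := by
  simp [spaceD, fderiv_sub (hV.analyticOnNhd q hq).differentiableAt
    (hW.analyticOnNhd q hq).differentiableAt]

/-! ### Orders of vanishing at time zero -/

lemma isBigO_one (hε : 0 < ε) (hW : IsAnalyticOnCylinder ε W) :
    W =O[timeToZero] fun _ => (1 : ℝ) := by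
  have hsub : Icc (0 : ℝ) 1 ×ˢ Icc (-(ε / 2)) (ε / 2) ⊆ strip ε := fun q hq =>
    mem_strip.2 ⟨by linarith [hq.2.1], by linarith [hq.2.2]⟩
  obtain ⟨C, hC⟩ := (isCompact_Icc.prod isCompact_Icc).exists_bound_of_continuousOn
    (hW.analyticOnNhd.continuousOn.mono hsub)
  refine .of_bound C (eventually_timeToZero.2 ⟨ε / 2, half_pos hε, fun x t ht => ?_⟩)
  obtain ⟨y, hy, hxy⟩ := (hW.periodic t (abs_lt.1 (ht.trans (half_lt_self hε)))
    ).exists_mem_Ico₀ zero_lt_one x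
  simpa [hxy] using hC (y, t) ⟨Ico_subset_Icc_self hy, abs_le.1 ht.le⟩

lemma isBigO_pow_succ_of_timeD (hε : 0 < ε) (hW : IsAnalyticOnCylinder ε W)
    (hzero : ∀ x, W (x, 0) = 0) (h : timeD W =O[timeToZero] fun q => q.2 ^ k) :
    W =O[timeToZero] fun q => q.2 ^ (k + 1) := by
  obtain ⟨C, hC₀, hC⟩ := h.exists_nonneg
  obtain ⟨δ, hδ, hbound⟩ := eventually_timeToZero.1 (hC.bound.and (strip_mem_timeToZero hε))
  refine .of_bound C (eventually_timeToZero.2 ⟨δ, hδ, fun x t ht => ?_⟩)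
  have habs : ∀ s ∈ uIcc 0 t, |s| ≤ |t| := fun s hs => by
    simpa using abs_sub_left_of_mem_uIcc hs
  have hderiv : ∀ s ∈ uIcc 0 t,
      HasDerivWithinAt (fun τ => W (x, τ)) (timeD W (x, s)) (uIcc 0 t) s := fun s hs =>
    (hW.hasDerivAt_time x
      (mem_strip.1 (hbound x s ((habs s hs).trans_lt ht)).2)).hasDerivWithinAt
  have hle : ∀ s ∈ uIcc 0 t, ‖timeD W (x, s)‖ ≤ C * ‖t ^ k‖ := fun s hs => by
    refine (hbound x s ((habs s hs).trans_lt ht)).1.trans ?_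
    rw [norm_pow, norm_pow]
    gcongr
    exact habs s hs
  have hmean := (convex_uIcc 0 t).norm_image_sub_le_of_norm_hasDerivWithin_le hderiv hle
    left_mem_uIcc right_mem_uIcc
  simpa [hzero, pow_succ, mul_assoc] using hmean

end IsAnalyticOnCylinder

lemma le_analyticOrderAt_of_isBigO {g : ℝ → ℝ} {k : ℕ} (hg : AnalyticAt ℝ g 0)
    (h : g =O[𝓝 0] fun t => t ^ k) : (k : ℕ∞) ≤ analyticOrderAt g 0 := by
  by_contra! hlt
  obtain ⟨n, hn⟩ := ENat.ne_top_iff_exists.1 hlt.ne_top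
  obtain ⟨q, hq, hq0, hgq⟩ := hg.analyticOrderAt_eq_natCast.1 hn.symm
  have hnk : n < k := by rwa [← hn, Nat.cast_lt] at hlt
  have hpow : (fun t : ℝ => t ^ n) =O[𝓝 0] g := by
    have hinv : (fun t => (q t)⁻¹) =O[𝓝 0] fun _ => (1 : ℝ) :=
      (hq.continuousAt.inv₀ hq0).tendsto.isBigO_one ℝ
    refine ((Asymptotics.isBigO_refl g (𝓝 0)).mul hinv).congr' ?_ (by simp)
    filter_upwards [hgq, hq.continuousAt.eventually_ne hq0] with t ht hqt
    simp [ht, hqt]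
  have hne : ∃ᶠ t : ℝ in 𝓝 0, t ^ n ≠ 0 :=
    ((eventually_mem_nhdsWithin (s := {0}ᶜ)).frequently.filter_mono nhdsWithin_le_nhds).mono
      fun _ => pow_ne_zero n
  exact (hpow.trans h).not_isLittleO hne (Asymptotics.isLittleO_pow_pow hnk)

namespace IsAnalyticOnCylinder

variable {ε t : ℝ} {V W : ℝ × ℝ → ℝ} {k : ℕ}

lemma succ_le_analyticOrderAt_iff (hε : 0 < ε) (hW : IsAnalyticOnCylinder ε W) (x : ℝ) :
    ((k + 1 : ℕ) : ℕ∞) ≤ analyticOrderAt (fun t => W (x, t)) 0 ↔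
      W (x, 0) = 0 ∧ (k : ℕ∞) ≤ analyticOrderAt (fun t => timeD W (x, t)) 0 := by
  have hslice := hW.analyticAt_slice x (zero_mem_Ioo_neg hε)
  have hderiv : deriv (fun t => W (x, t)) =ᶠ[𝓝 0] fun t => timeD W (x, t) := by
    filter_upwards [isOpen_Ioo.mem_nhds (zero_mem_Ioo_neg hε)] with t ht
    exact (hW.hasDerivAt_time x ht).deriv
  rw [← analyticOrderAt_congr hderiv]
  refine ⟨fun h => ?_, fun ⟨hzero, h⟩ => ?_⟩
  · have hzero : W (x, 0) = 0 :=
      apply_eq_zero_of_analyticOrderAt_ne_zero (f := fun t => W (x, t)) fun h0 => by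
        simp [h0, -Nat.cast_add] at h
    exact ⟨hzero, (analyticOrderAt_deriv_ge_iff hslice hzero).2 (mod_cast h)⟩
  · exact_mod_cast (analyticOrderAt_deriv_ge_iff hslice hzero).1 h

lemma isBigO_pow_iff (hε : 0 < ε) (hW : IsAnalyticOnCylinder ε W) :
    (W =O[timeToZero] fun q => q.2 ^ k) ↔
      ∀ x, (k : ℕ∞) ≤ analyticOrderAt (fun t => W (x, t)) 0 := by
  refine ⟨fun h x => le_analyticOrderAt_of_isBigO (hW.analyticAt_slice x (zero_mem_Ioo_neg hε))
    (h.comp_tendsto (tendsto_timeToZero x)), fun h => ?_⟩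
  induction k generalizing W with
  | zero => simpa only [pow_zero] using hW.isBigO_one hε
  | succ k ih =>
    simp only [hW.succ_le_analyticOrderAt_iff hε, forall_and] at h
    exact hW.isBigO_pow_succ_of_timeD hε h.1 (ih hW.timeD h.2)

lemma isBigO_pow_succ_iff (hε : 0 < ε) (hW : IsAnalyticOnCylinder ε W) :
    (W =O[timeToZero] fun q => q.2 ^ (k + 1)) ↔
      (∀ x, W (x, 0) = 0) ∧ timeD W =O[timeToZero] fun q => q.2 ^ k := by
  simp only [hW.isBigO_pow_iff hε, hW.timeD.isBigO_pow_iff hε,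
    hW.succ_le_analyticOrderAt_iff hε, forall_and]

lemma isBigO_spaceD (hε : 0 < ε) (hW : IsAnalyticOnCylinder ε W)
    (h : W =O[timeToZero] fun q => q.2 ^ k) : spaceD W =O[timeToZero] fun q => q.2 ^ k := by
  induction k generalizing W with
  | zero => simpa only [pow_zero] using hW.spaceD.isBigO_one hε
  | succ k ih =>
    rw [hW.isBigO_pow_succ_iff hε] at h
    refine (hW.spaceD.isBigO_pow_succ_iff hε).2 ⟨fun x => ?_, ?_⟩
    · have hx := hW.hasDerivAt_space x (zero_mem_Ioo_neg hε)
      simp only [h.1] at hx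
      exact hx.unique (hasDerivAt_const x 0)
    · refine (ih hW.timeD h.2).congr' ?_ .rfl
      filter_upwards [strip_mem_timeToZero hε] with q hq using (hW.timeD_spaceD hq).symm

lemma eq_zero_of_forall_isBigO_pow (hε : 0 < ε) (hW : IsAnalyticOnCylinder ε W)
    (h : ∀ k : ℕ, W =O[timeToZero] fun q => q.2 ^ k) {x : ℝ} (ht : t ∈ Ioo (-ε) ε) :
    W (x, t) = 0 := by
  have htop : analyticOrderAt (fun t => W (x, t)) 0 = ⊤ :=
    ENat.eq_top_iff_forall_ge.2 fun k => (hW.isBigO_pow_iff hε).1 (h k) x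
  exact AnalyticOnNhd.eqOn_zero_of_preconnected_of_eventuallyEq_zero
    (f := fun t => W (x, t)) (fun s hs => hW.analyticAt_slice x hs)
    isPreconnected_Ioo (zero_mem_Ioo_neg hε) (analyticOrderAt_eq_top.1 htop) ht

lemma isBigO_spaceD_sub (hε : 0 < ε) (hV : IsAnalyticOnCylinder ε V)
    (hW : IsAnalyticOnCylinder ε W) (h : (V - W) =O[timeToZero] fun q => q.2 ^ k) :
    (spaceD V - spaceD W) =O[timeToZero] fun q => q.2 ^ k := by
  refine ((hV.sub hW).isBigO_spaceD hε h).congr' ?_ .rfl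
  filter_upwards [strip_mem_timeToZero hε] with q hq using hV.spaceD_sub hW hq

lemma isBigO_mul_sub_mul (hε : 0 < ε) {V' W' : ℝ × ℝ → ℝ} (hV : IsAnalyticOnCylinder ε V)
    (hW' : IsAnalyticOnCylinder ε W') (h : (V - W) =O[timeToZero] fun q => q.2 ^ k)
    (h' : (V' - W') =O[timeToZero] fun q => q.2 ^ k) :
    (V * V' - W * W') =O[timeToZero] fun q => q.2 ^ k := by
  have hsplit : V * V' - W * W' = V * (V' - W') + (V - W) * W' := by ring
  rw [hsplit]
  exact (((hV.isBigO_one hε).mul h').congr_right fun _ => one_mul _).add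
    ((h.mul (hW'.isBigO_one hε)).congr_right fun _ => mul_one _)

lemma isBigO_pow_sub_pow (hε : 0 < ε) (hV : IsAnalyticOnCylinder ε V)
    (hW : IsAnalyticOnCylinder ε W) (h : (V - W) =O[timeToZero] fun q => q.2 ^ k) (n : ℕ) :
    (V ^ n - W ^ n) =O[timeToZero] fun q => q.2 ^ k := by
  induction n with
  | zero => simpa only [pow_zero, sub_self] using! Asymptotics.isBigO_zero _ _
  | succ n ih =>
    simpa only [pow_succ] using (hV.pow n).isBigO_mul_sub_mul hε hW ih h

lemma isBigO_invDeriv_sub (hε : 0 < ε) (hV : IsAnalyticOnCylinder ε V)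
    (hW : IsAnalyticOnCylinder ε W) (h : (V - W) =O[timeToZero] fun q => q.2 ^ k) (x₀ : ℝ) :
    (fun q => invDeriv x₀ (fun y => V (y, q.2)) q.1 - invDeriv x₀ (fun y => W (y, q.2)) q.1)
      =O[timeToZero] fun q => q.2 ^ k := by
  obtain ⟨C, hC⟩ := h.bound
  obtain ⟨δ, hδ, hbound⟩ := eventually_timeToZero.1 (hC.and (strip_mem_timeToZero hε))
  refine .of_bound (2 * C) (eventually_timeToZero.2 ⟨δ, hδ, fun x t ht => ?_⟩)
  have ht' := mem_strip.1 (hbound x t ht).2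
  have hle := abs_invDeriv_le ((hV.sub hW).continuous_slice ht') ((hV.sub hW).periodic t ht')
    (C := C * ‖t ^ k‖) (fun y => (hbound y t ht).1) x₀ x
  have hsub := congrFun (invDeriv_sub (hV.continuous_slice ht') (hW.continuous_slice ht') x₀) x
  rw [mul_assoc, Real.norm_eq_abs, ← Pi.sub_apply, ← hsub]
  exact hle

end IsAnalyticOnCylinder

/-! ### Uniqueness -/

namespace IsAnalyticSolution

variable {p : ℕ} {x₀ ε t : ℝ} {u₀ : ℝ → ℝ} {u v : ℝ → ℝ → ℝ} {k : ℕ}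

lemma isAnalyticOnCylinder (hu : IsAnalyticSolution p x₀ u₀ ε u) :
    IsAnalyticOnCylinder ε (uncurry u) :=
  ⟨hu.analytic, hu.periodic⟩

lemma timeD_eq (hu : IsAnalyticSolution p x₀ u₀ ε u) (x : ℝ) (ht : t ∈ Ioo (-ε) ε) :
    timeD (uncurry u) (x, t) =
      1 / 2 * invDeriv x₀ (fun y => (spaceD (uncurry u ^ p) *
        spaceD (uncurry u)) (y, t)) x -
      (uncurry u ^ p * spaceD (uncurry u)) (x, t) := by
  have hU := hu.isAnalyticOnCylinder
  have hspace : deriv (fun z => u z t) = fun y => spaceD (uncurry u) (y, t) :=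
    funext fun y => (hU.hasDerivAt_space y ht).deriv
  have hpow : deriv (fun z => u z t ^ p) = fun y => spaceD (uncurry u ^ p) (y, t) :=
    funext fun y => ((hU.pow p).hasDerivAt_space y ht).deriv
  have htime : deriv (fun τ => u x τ) t = timeD (uncurry u) (x, t) :=
    (hU.hasDerivAt_time x ht).deriv
  have heq := hu.equation x t ht
  rw [htime, hspace, hpow] at heq
  exact eq_sub_of_add_eq heq

lemma isBigO_timeD_sub (hε : 0 < ε) (hu : IsAnalyticSolution p x₀ u₀ ε u)
    (hv : IsAnalyticSolution p x₀ u₀ ε v)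
    (h : (uncurry v - uncurry u) =O[timeToZero] fun q => q.2 ^ k) :
    timeD (uncurry v - uncurry u) =O[timeToZero] fun q => q.2 ^ k := by
  have hU := hu.isAnalyticOnCylinder
  have hV := hv.isAnalyticOnCylinder
  have hpow := hV.isBigO_pow_sub_pow hε hU h p
  have hspace := hV.isBigO_spaceD_sub hε hU h
  have htransport := (hV.pow p).isBigO_mul_sub_mul hε hU.spaceD hpow hspace
  have hquadratic := (hV.pow p).spaceD.isBigO_mul_sub_mul hε hU.spaceD
    ((hV.pow p).isBigO_spaceD_sub hε (hU.pow p) hpow) hspace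
  have hnonlocal := ((hV.pow p).spaceD.mul hV.spaceD).isBigO_invDeriv_sub hε
    ((hU.pow p).spaceD.mul hU.spaceD) hquadratic x₀
  refine ((hnonlocal.const_mul_left (1 / 2)).sub htransport).congr' ?_ .rfl
  filter_upwards [strip_mem_timeToZero hε] with ⟨x, t⟩ hq
  have ht := mem_strip.1 hq
  rw [hV.timeD_sub hU hq, hv.timeD_eq x ht, hu.timeD_eq x ht, Pi.sub_apply]
  ring

protected lemma eq (hε : 0 < ε) (hu : IsAnalyticSolution p x₀ u₀ ε u)
    (hv : IsAnalyticSolution p x₀ u₀ ε v) (x : ℝ) (ht : t ∈ Ioo (-ε) ε) : v x t = u x t := by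
  have hW := hv.isAnalyticOnCylinder.sub hu.isAnalyticOnCylinder
  refine sub_eq_zero.1 (hW.eq_zero_of_forall_isBigO_pow hε (fun k => ?_) (x := x) ht)
  induction k with
  | zero => simpa only [pow_zero] using hW.isBigO_one hε
  | succ k ih =>
    refine (hW.isBigO_pow_succ_iff hε).2 ⟨fun y => ?_, isBigO_timeD_sub hε hu hv ih⟩
    simp [Function.uncurry, hu.initial, hv.initial]

end IsAnalyticSolution

end ModifiedHunterSaxton

end

theorem mainTheorem3 (p : ℕ) (hp : 1 ≤ p) (x₀ : ℝ) (u₀ : ℝ → ℝ)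
    (hper : Function.Periodic u₀ 1) (han : AnalyticOnNhd ℝ u₀ Set.univ) :
    ∃ ε : ℝ, 0 < ε ∧ ∃ u : ℝ → ℝ → ℝ,
      ModifiedHunterSaxton.IsAnalyticSolution p x₀ u₀ ε u ∧
      ∀ v : ℝ → ℝ → ℝ, ModifiedHunterSaxton.IsAnalyticSolution p x₀ u₀ ε v →
        ∀ x : ℝ, ∀ t ∈ Set.Ioo (-ε) ε, v x t = u x t := by
  obtain ⟨ε, hε, u, hu⟩ := ModifiedHunterSaxton.exists_isAnalyticSolution p x₀ hper han
  exact ⟨ε, hε, u, hu, fun v hv x t ht => hu.eq hε hv x ht⟩
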